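/- Conventions. A digraph $D=(V,A)$ has a finite vertex set and an arc set $A\subseteq\{(u,v): u\neq v\}$; $n=|V|$, $m=|A|$. A walk is a nonempty vertex sequence $(v_0,\dots,v_\ell)$ with $(v_i,v_{i+1})\in A$ for all $i<\ell$; it is a path if no vertex repeats, and a cycle if $\ell\ge 2$, $v_0=v_\ell$ and $v_0,\dots,v_{\ell-1}$ are pairwise distinct. $D$ is acyclic if it contains no cycle. An ear is a path or a cycle, and it is maximal if it is not a proper subgraph of another ear. An identifying sequence for an ear $P$ is a sequence $(a_1,\dots,a_k)$, $k\ge 1$, of arcs of $P$, listed in the order in which they occur along $P$, such that every ear of $D$ containing $a_1,\dots,a_k$ in this order is a subgraph of $P$. The ear anonymity of a maximal ear $P$ is the length of a shortest identifying sequence for $P$, and $0$ if $P$ has no arcs. The ear anonymity of $D$ is the maximum ear anonymity of its maximal ears ($0$ if $V=\emptyset$). Theorem. There is an algorithm which, given an acyclic digraph $D$ with vertex set $\{0,\dots,n-1\}$ and $m$ arcs (as the numbers $n$ and $m$ and a list of the arcs in arbitrary order, each arc once), computes the ear anonymity of $D$ in $O(m(n+m))$ time. Precisely, there are a program for a random access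 machine (unit-cost addition, truncated subtraction, comparison and indexed memory access, on words of $O(\log(n+m+2))$ bits) and a constant $c$ such that on every such input the program halts after at most $c\,(m(n+m)+1)$ steps and outputs the ear anonymity of $D$. -/

import Mathlib

/-! ## Ear anonymity of digraphs -/

namespace EarAnonymity

section Ears

variable {V : Type*}

/-- The sequence of arcs traversed by the vertex sequence `W`. -/
def arcs (W : List V) : List (V × V) := W.zip W.tail

/-- A walk of length `ℓ`: a sequence `v₀, …, v_ℓ` with consecutive vertices joined by arcs. -/
def IsWalk (D : Digraph V) (W : List V) : Prop := W ≠ [] ∧ W.IsChain D.Adj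

/-- A path: a walk on which no vertex appears twice (a single vertex is a path). -/
def IsPath (D : Digraph V) (W : List V) : Prop := IsWalk D W ∧ W.Nodup

/-- A cycle: a walk `v₀, …, v_ℓ` with `v₀ = v_ℓ`, with `ℓ ≥ 2`, and with
`v₀, …, v_{ℓ-1}` pairwise distinct. -/
def IsCycle (D : Digraph V) (W : List V) : Prop :=
  IsWalk D W ∧ W.head? = W.getLast? ∧ W.dropLast.Nodup ∧ 3 ≤ W.length

/-- A digraph is acyclic if it contains no cycle. -/
def IsAcyclic (D : Digraph V) : Prop := ∀ W : List V, ¬ IsCycle D W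

/-- A (directed) ear is a path or a cycle. -/
def IsEar (D : Digraph V) (W : List V) : Prop := IsPath D W ∨ IsCycle D W

/-- `Q` is a subgraph of `P`: every vertex of `Q` is on `P` and every arc of `Q` is an arc of `P`
(here `⊆` on lists is inclusion of the sets of members). -/
def IsSubgraph (Q P : List V) : Prop := Q ⊆ P ∧ arcs Q ⊆ arcs P

/-- An ear that is maximal with respect to the subgraph relation. -/
def IsMaximalEar (D : Digraph V) (P : List V) : Prop :=
  IsEar D P ∧ ∀ Q : List V, IsEar D Q → IsSubgraph P Q → IsSubgraph Q P

/-- `a` is an identifying sequence for the ear `P`: it is a nonempty sequence of arcs of `P`, in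
the order in which they occur along `P`, and every ear containing these arcs in this order is a
subgraph of `P` (`<+` means: is a, not necessarily contiguous, subsequence of). -/
def IsIdentifyingSequence (D : Digraph V) (P : List V) (a : List (V × V)) : Prop :=
  a ≠ [] ∧ a.Sublist (arcs P) ∧
    ∀ Q : List V, IsEar D Q → a.Sublist (arcs Q) → IsSubgraph Q P

open Classical in
/-- The ear anonymity of a maximal ear `P`: the length of a shortest identifying sequence for `P`,
and `0` if `P` has no arcs. -/
noncomputable def anonOfEar (D : Digraph V) (P : List V) : ℕ :=
  if arcs P = [] then 0
  else sInf {k : ℕ | ∃ a : List (V × V), IsIdentifyingSequence D P a ∧ a.length = k}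

/-- The ear anonymity of a digraph: the maximum ear anonymity of its maximal ears
(`0` for the digraph without vertices, which has no ears). -/
noncomputable def anon (D : Digraph V) : ℕ :=
  sSup {k : ℕ | ∃ P : List V, IsMaximalEar D P ∧ anonOfEar D P = k}

/-- In a finite digraph the set whose supremum is taken in `anon` is bounded, so that `anon` is a
genuine maximum. -/
theorem bddAbove_anonOfEar [Finite V] (D : Digraph V) :
    BddAbove {k : ℕ | ∃ P : List V, IsMaximalEar D P ∧ anonOfEar D P = k} := by
  classical
  have := Fintype.ofFinite V
  refine ⟨Fintype.card V + 1, ?_⟩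
  rintro k ⟨P, hP, rfl⟩
  have hlen : P.length ≤ Fintype.card V + 1 := by
    rcases hP.1 with h | h
    · exact (List.Nodup.length_le_card h.2).trans (Nat.le_succ _)
    · have := List.Nodup.length_le_card h.2.2.1
      simp only [List.length_dropLast] at this
      omega
  unfold anonOfEar
  split_ifs with h0
  · omega
  · rcases Set.eq_empty_or_nonempty
      {k : ℕ | ∃ a : List (V × V), IsIdentifyingSequence D P a ∧ a.length = k} with he | ⟨k, hk⟩
    · rw [he]; simp
    · refine (Nat.sInf_le hk).trans ?_
      obtain ⟨a, ha, rfl⟩ := hk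
      have h1 := ha.2.1.length_le
      simp only [arcs, List.length_zip, List.length_tail] at h1
      omega

end Ears

/-! ## Random access machines

A unit-cost random access machine with bounded words, programmed by structured programs.  The
memory consists of registers `reg i` and of arrays `mem a`; a program is a fixed finite text, so
that it mentions finitely many registers and arrays (their names `i`, `a` are literals). -/

/-- The contents of the registers and of the arrays: `mem a j` is the `j`-th cell of array `a`. -/
structure State where
  reg : ℕ → ℕ
  mem : ℕ → ℕ → ℕ

/-- Expressions: literals, registers, array cells, sums, truncated differences, and the tests
`<` and `=` (with value `1` if true and `0` if false). -/
inductive Expr where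
  | const (k : ℕ)
  | reg (i : ℕ)
  | get (a : ℕ) (e : Expr)
  | add (e f : Expr)
  | sub (e f : Expr)
  | lt (e f : Expr)
  | eq (e f : Expr)

/-- The value of an expression. -/
def Expr.eval (s : State) : Expr → ℕ
  | .const k => k
  | .reg i => s.reg i
  | .get a e => s.mem a (e.eval s)
  | .add e f => e.eval s + f.eval s
  | .sub e f => e.eval s - f.eval s
  | .lt e f => if e.eval s < f.eval s then 1 else 0
  | .eq e f => if e.eval s = f.eval s then 1 else 0

/-- The cost of evaluating an expression: one step for each node of the expression. -/
def Expr.cost : Expr → ℕ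
  | .const _ => 1
  | .reg _ => 1
  | .get _ e => e.cost + 1
  | .add e f => e.cost + f.cost + 1
  | .sub e f => e.cost + f.cost + 1
  | .lt e f => e.cost + f.cost + 1
  | .eq e f => e.cost + f.cost + 1

/-- Programs.  `set i e` stores the value of `e` in register `i`, `put a e f` stores the value of
`f` in the cell of array `a` whose index is the value of `e`; a test succeeds if its value is
not `0`. -/
inductive Prog where
  | skip
  | set (i : ℕ) (e : Expr)
  | put (a : ℕ) (e f : Expr)
  | seq (p q : Prog)
  | ite (e : Expr) (p q : Prog)
  | while (e : Expr) (p : Prog)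

/-- `Exec B p s t s'`: on a machine whose cells hold the numbers `0, …, B`, the program `p`
started in state `s` halts after exactly `t` steps in state `s'`.  A program that tries to store
a number larger than `B`, or to access an array for writing at an index larger than `B`,
gets stuck and has no execution. -/
inductive Exec (B : ℕ) : Prog → State → ℕ → State → Prop where
  | skip (s : State) : Exec B .skip s 1 s
  | set (s : State) (i : ℕ) (e : Expr) (he : e.eval s ≤ B) :
      Exec B (.set i e) s (e.cost + 1) ⟨Function.update s.reg i (e.eval s), s.mem⟩
  | put (s : State) (a : ℕ) (e f : Expr) (he : e.eval s ≤ B) (hf : f.eval s ≤ B) :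
      Exec B (.put a e f) s (e.cost + f.cost + 1)
        ⟨s.reg, Function.update s.mem a (Function.update (s.mem a) (e.eval s) (f.eval s))⟩
  | seq {p q : Prog} {s s' s'' : State} {t t' : ℕ} (hp : Exec B p s t s')
      (hq : Exec B q s' t' s'') : Exec B (.seq p q) s (t + t') s''
  | iteTrue {e : Expr} {p q : Prog} {s s' : State} {t : ℕ} (he : e.eval s ≠ 0)
      (hp : Exec B p s t s') : Exec B (.ite e p q) s (e.cost + 1 + t) s'
  | iteFalse {e : Expr} {p q : Prog} {s s' : State} {t : ℕ} (he : e.eval s = 0)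
      (hq : Exec B q s t s') : Exec B (.ite e p q) s (e.cost + 1 + t) s'
  | whileTrue {e : Expr} {p : Prog} {s s' s'' : State} {t t' : ℕ} (he : e.eval s ≠ 0)
      (hp : Exec B p s t s') (hw : Exec B (.while e p) s' t' s'') :
      Exec B (.while e p) s (e.cost + 1 + t + t') s''
  | whileFalse {e : Expr} {p : Prog} {s : State} (he : e.eval s = 0) :
      Exec B (.while e p) s (e.cost + 1) s

/-- `L` lists the arcs of `D`, each exactly once, in an arbitrary order. -/
def IsArcList {V : Type*} (D : Digraph V) (L : List (V × V)) : Prop :=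
  L.Nodup ∧ ∀ u v : V, (u, v) ∈ L ↔ D.Adj u v

/-- The initial state for the digraph with vertices `0, …, n - 1` and arc list `L`: register `0`
holds the number `n` of vertices, register `1` the number of arcs, cell `j` of array `0` the tail
and cell `j` of array `1` the head of the `j`-th arc; everything else is `0`. -/
def inputState (n : ℕ) (L : List (Fin n × Fin n)) : State where
  reg := fun i => if i = 0 then n else if i = 1 then L.length else 0
  mem := fun a j =>
    if a = 0 then (L.map fun x => (x.1 : ℕ)).getD j 0
    else if a = 1 then (L.map fun x => (x.2 : ℕ)).getD j 0
    else 0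

end EarAnonymity

/-! Without loops and cycles every walk is a path, so the maximal ears are the walks from a source
to a sink. An identifying sequence of such a path must spend an arc for each of the following
reasons: the path enters a vertex of in-degree at least two, so that its beginning could be
exchanged; it runs from `x` to `v` although a second route from `x` to `v` exists; it leaves a
vertex of out-degree at least two, so that its end could be exchanged. Reasons located on
arc-disjoint segments need different arcs. `Level D v k` stacks `k` reasons of the first two kinds
on one walk to `v`, and `Level.exists_walk` turns this into a lower bound.

Conversely, scan a path and take an arc only when forced: the arc into the first vertex with another
in-arc, and afterwards, `w` being the head of the last arc taken, the arc into the first vertex with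
a second route from `w`. Every arc taken raises the level by one. At the sink one more arc is needed
only if a branching vertex occurs after the last choice (`exists_identifying_before`,
`exists_identifying_after`). Hence `anon_eq_of_level`: the anonymity is the maximum of `1`, the
levels, and the levels plus one at branching vertices.

The levels are found by dynamic programming over the arcs, sorted by the height of the tail. For
each arc one sweep counts the routes from its tail, capped at two (`IsRouteCount.concat`), and one
pass over the vertices updates the levels (`IsLevelBound.relax`). These are `m` rounds of cost `O(n
+ m)`; heights and sorting cost `O(nm)`. -/

namespace EarAnonymity

/-! ### Arcs of vertex sequences, and routes. -/

section Lists

variable {V : Type*}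

@[simp] theorem arcs_nil : arcs ([] : List V) = [] := rfl

@[simp] theorem arcs_singleton (v : V) : arcs [v] = [] := rfl

@[simp] theorem arcs_cons_cons (a b : V) (l : List V) :
    arcs (a :: b :: l) = (a, b) :: arcs (b :: l) := rfl

theorem arcs_append (p y : List V) (v : V) :
    arcs (p ++ v :: y) = arcs (p ++ [v]) ++ arcs (v :: y) := by
  induction p with
  | nil => simp
  | cons a p ih => cases p <;> simp_all

theorem mem_arcs_iff {a b : V} {W : List V} :
    (a, b) ∈ arcs W ↔ ∃ p q, W = p ++ a :: b :: q := by
  constructor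
  · induction W with
    | nil => simp
    | cons x W ih =>
      cases W with
      | nil => simp
      | cons y W =>
        rw [arcs_cons_cons, List.mem_cons]
        rintro (h | h)
        · cases h
          exact ⟨[], W, rfl⟩
        · obtain ⟨p, q, h⟩ := ih h
          exact ⟨x :: p, q, by simp [h]⟩
  · rintro ⟨p, q, rfl⟩
    rw [arcs_append]
    simp

theorem arcs_subset_of_infix {Q P : List V} (h : Q <:+: P) : arcs Q ⊆ arcs P := by
  rintro ⟨a, b⟩ hab
  obtain ⟨p, q, rfl⟩ := mem_arcs_iff.1 hab
  obtain ⟨s, t, rfl⟩ := h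
  exact mem_arcs_iff.2 ⟨s ++ p, q ++ t, by simp⟩

theorem isSubgraph_of_infix {Q P : List V} (h : Q <:+: P) : IsSubgraph Q P :=
  ⟨h.subset, arcs_subset_of_infix h⟩

theorem isChain_iff_arcs {R : V → V → Prop} {W : List V} :
    W.IsChain R ↔ ∀ a b, (a, b) ∈ arcs W → R a b := by
  induction W with
  | nil => simp
  | cons x W ih =>
    cases W with
    | nil => simp
    | cons y W =>
      rw [List.isChain_cons_cons, ih]
      simp only [arcs_cons_cons, List.mem_cons, Prod.mk.injEq]
      constructor
      · rintro ⟨h, h'⟩ a b (⟨rfl, rfl⟩ | hab)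
        · exact h
        · exact h' a b hab
      · exact fun h => ⟨h x y (.inl ⟨rfl, rfl⟩), fun a b hab => h a b (.inr hab)⟩

theorem isChain_arcs (W : List V) : W.IsChain (fun a b => (a, b) ∈ arcs W) :=
  isChain_iff_arcs.2 fun _ _ h => h

theorem left_mem_of_mem_arcs {a b : V} {W : List V} (h : (a, b) ∈ arcs W) : a ∈ W := by
  obtain ⟨p, q, rfl⟩ := mem_arcs_iff.1 h
  simp

theorem right_mem_of_mem_arcs {a b : V} {W : List V} (h : (a, b) ∈ arcs W) : b ∈ W := by
  obtain ⟨p, q, rfl⟩ := mem_arcs_iff.1 h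
  simp

theorem right_unique_of_mem_arcs {a b c : V} {W : List V} (hW : W.Nodup)
    (hb : (a, b) ∈ arcs W) (hc : (a, c) ∈ arcs W) : b = c := by
  induction W with
  | nil => simp at hb
  | cons x W ih =>
    cases W with
    | nil => simp at hb
    | cons y W =>
      rw [arcs_cons_cons, List.mem_cons] at hb hc
      have hx := (List.nodup_cons.1 hW).1
      rcases hb with hb | hb <;> rcases hc with hc | hc
      · cases hb; cases hc; rfl
      · cases hb; exact absurd (left_mem_of_mem_arcs hc) hx
      · cases hc; exact absurd (left_mem_of_mem_arcs hb) hx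
      · exact ih (List.nodup_cons.1 hW).2 hb hc

theorem left_unique_of_mem_arcs {a b c : V} {W : List V} (hW : W.Nodup)
    (ha : (a, c) ∈ arcs W) (hb : (b, c) ∈ arcs W) : a = b := by
  induction W with
  | nil => simp at ha
  | cons x W ih =>
    have hW' := (List.nodup_cons.1 hW).2
    cases W with
    | nil => simp at ha
    | cons y W =>
      rw [arcs_cons_cons, List.mem_cons] at ha hb
      have key : ∀ d, (d, y) ∉ arcs (y :: W) := by
        intro d hd
        cases W with
        | nil => simp at hd
        | cons z W =>
          have hy := (List.nodup_cons.1 hW').1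
          rw [arcs_cons_cons, List.mem_cons] at hd
          rcases hd with hd | hd
          · cases hd; simp at hy
          · exact hy (right_mem_of_mem_arcs hd)
      rcases ha with ha | ha <;> rcases hb with hb | hb
      · cases ha; cases hb; rfl
      · cases ha; exact absurd hb (key _)
      · cases hb; exact absurd ha (key _)
      · exact ih hW' ha hb

/-- A walk traversing the arc `(u, z)` before the arcs `b` splits at `(u, z)`. -/
theorem exists_split_of_cons_sublist_arcs {u z : V} {b : List (V × V)} {W : List V}
    (h : ((u, z) :: b).Sublist (arcs W)) :
    ∃ r r', W = r ++ u :: z :: r' ∧ b.Sublist (arcs (z :: r')) := by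
  induction W with
  | nil => simp at h
  | cons x W ih =>
    cases W with
    | nil => simp at h
    | cons y W =>
      rw [arcs_cons_cons] at h
      cases h with
      | cons _ h =>
        obtain ⟨r, r', h, h'⟩ := ih h
        exact ⟨x :: r, r', by simp [h], h'⟩
      | cons_cons _ h => exact ⟨[], W, rfl, h⟩

/-- Two chains from the same element, the first of which never branches, are comparable. -/
theorem prefix_or_prefix_of_isChain {R : V → V → Prop} {x : V} {l l' : List V}
    (hl : (x :: l).IsChain R) (hl' : (x :: l').IsChain R)
    (hR : ∀ a ∈ x :: l, ∀ b c, R a b → R a c → b = c) :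
    (x :: l) <+: (x :: l') ∨ (x :: l') <+: (x :: l) := by
  induction l generalizing x l' with
  | nil => exact .inl (by simp)
  | cons y l ih =>
    cases l' with
    | nil => exact .inr (by simp)
    | cons z l' =>
      rw [List.isChain_cons_cons] at hl hl'
      obtain rfl := hR x (by simp) y z hl.1 hl'.1
      rcases ih hl.2 hl'.2 (fun a ha => hR a (List.mem_cons_of_mem _ ha)) with h | h
      · exact .inl ((List.prefix_cons_inj x).2 h)
      · exact .inr ((List.prefix_cons_inj x).2 h)

/-- `Route R x v l`: the sequence `l` followed by `v` is a walk from `x` to `v`. -/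
def Route (R : V → V → Prop) (x v : V) (l : List V) : Prop :=
  (l ++ [v]).IsChain R ∧ (l ++ [v]).head? = some x

variable {R : V → V → Prop} {x u v : V} {l : List V}

theorem route_nil : Route R x v [] ↔ v = x := by simp [Route]

theorem route_snoc : Route R x v (l ++ [u]) ↔ Route R x u l ∧ R u v := by
  simp only [Route, List.append_assoc, List.singleton_append, List.isChain_append_cons_cons]
  cases l <;> simp <;> tauto

theorem Route.exists_eq (h : Route R x v l) : ∃ l', l ++ [v] = x :: l' := by
  obtain ⟨_, h⟩ := h
  cases l with
  | nil => exact ⟨[], by simpa using h⟩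
  | cons a l => exact ⟨l ++ [v], by simpa using h⟩

theorem Route.eq_nil_or (h : Route R x v l) : (l = [] ∧ v = x) ∨ ∃ l', l = x :: l' := by
  cases l with
  | nil => exact .inl ⟨rfl, route_nil.1 h⟩
  | cons a l => exact .inr ⟨l, by simpa using h.2⟩

theorem Route.mono {S : V → V → Prop} (hRS : ∀ a b, R a b → S a b) (h : Route R x v l) :
    Route S x v l := ⟨h.1.imp fun a b => hRS a b, h.2⟩

end Lists

/-! ### Ears of acyclic digraphs. -/

section Acyclic

variable {V : Type*} {D : Digraph V}

/-- In an acyclic digraph without loops no walk repeats a vertex. -/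
theorem IsAcyclic.nodup_of_isChain (hD : IsAcyclic D) (hloop : ∀ v, ¬ D.Adj v v) {W : List V}
    (hW : W.IsChain D.Adj) : W.Nodup := by
  induction W with
  | nil => simp
  | cons a W ih =>
    have hW' := ih (List.IsChain.tail hW)
    refine List.nodup_cons.2 ⟨fun ha => ?_, hW'⟩
    obtain ⟨s, t, rfl⟩ := List.append_of_mem ha
    have h1 : (a :: s ++ [a]).IsChain D.Adj := hW.prefix ⟨t, by simp⟩
    have h2 : (s ++ [a]).Nodup := hW'.sublist (by simp)
    refine hD (a :: s ++ [a]) ⟨⟨by simp, h1⟩, by rw [List.getLast?_concat]; rfl, ?_, ?_⟩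
    · rw [List.dropLast_concat]
      rw [List.nodup_append] at h2
      exact List.nodup_cons.2 ⟨fun h => h2.2.2 a h a (by simp) rfl, h2.1⟩
    -- For empty `s` the closed walk is a loop, which is too short to count as a cycle and is
    -- excluded separately.
    · cases s with
      | nil => exact absurd (by simpa using h1) (hloop a)
      | cons b s => simp

variable (hN : ∀ W : List V, W.IsChain D.Adj → W.Nodup)
include hN

theorem isEar_iff_of_nodup {W : List V} :
    IsEar D W ↔ W ≠ [] ∧ W.IsChain D.Adj := by
  constructor
  · rintro (h | h)
    · exact h.1
    · exact h.1
  · exact fun h => .inl ⟨h, hN W h.2⟩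

theorem route_self_iff {x : V} {l : List V} : Route D.Adj x x l ↔ l = [] := by
  constructor
  · intro h
    rcases h.eq_nil_or with h' | ⟨l', rfl⟩
    · exact h'.1
    · have := hN _ h.1
      simp at this
  · rintro rfl
    exact route_nil.2 rfl

/-- An in-neighbour of the first vertex or an out-neighbour of the last would extend the ear.
Conversely, inside a larger ear `Q` a source must come first; successors along `Q` are unique, so
one of `P`, `Q` is a prefix of the other, and nothing follows a sink. -/
theorem isMaximalEar_iff {P : List V} :
    IsMaximalEar D P ↔ P ≠ [] ∧ P.IsChain D.Adj ∧ (∀ x ∈ P.head?, ∀ u, ¬ D.Adj u x) ∧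
      ∀ x ∈ P.getLast?, ∀ u, ¬ D.Adj x u := by
  simp only [IsMaximalEar, isEar_iff_of_nodup hN]
  constructor
  · rintro ⟨⟨hne, hP⟩, hmax⟩
    refine ⟨hne, hP, fun x hx u hu => ?_, fun x hx u hu => ?_⟩
    · have hc : (u :: P).IsChain D.Adj :=
        List.isChain_cons.2 ⟨fun y hy => by cases Option.mem_unique hx hy; exact hu, hP⟩
      have := (hmax (u :: P) ⟨by simp, hc⟩ (isSubgraph_of_infix ⟨[u], [], by simp⟩)).1
      exact (List.nodup_cons.1 (hN _ hc)).1 (this (by simp))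
    · have hc : (P ++ [u]).IsChain D.Adj :=
        List.isChain_append.2 ⟨hP, by simp, fun y hy z hz => by
          cases Option.mem_unique hx hy; simp at hz; subst hz; exact hu⟩
      have := (hmax (P ++ [u]) ⟨by simp, hc⟩ (isSubgraph_of_infix ⟨[], [u], by simp⟩)).1
      have h2 := hN _ hc
      rw [List.nodup_append] at h2
      exact h2.2.2 u (this (by simp)) u (by simp) rfl
  · rintro ⟨hne, hP, hs, ht⟩
    refine ⟨⟨hne, hP⟩, ?_⟩
    rintro Q ⟨-, hQ⟩ ⟨hPQ, hPQ'⟩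
    obtain ⟨h, P, rfl⟩ := List.exists_cons_of_ne_nil hne
    obtain ⟨q, q', rfl⟩ := List.append_of_mem (hPQ (List.mem_cons_self))
    rcases List.eq_nil_or_concat q with rfl | ⟨q, u, rfl⟩
    · rw [List.nil_append] at *
      have h1 : (h :: P).IsChain (fun a b => (a, b) ∈ arcs (h :: q')) :=
        (isChain_arcs _).imp fun a b hab => hPQ' hab
      rcases prefix_or_prefix_of_isChain h1 (isChain_arcs (h :: q'))
        (fun a _ b c => right_unique_of_mem_arcs (hN _ hQ)) with ⟨t, ht'⟩ | h2
      · cases t with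
        | nil => exact isSubgraph_of_infix ⟨[], [], by simp [← ht']⟩
        | cons z t =>
          rw [← ht'] at hQ
          exact absurd ((List.isChain_append.1 hQ).2.2 _ (List.getLast?_eq_some_getLast (by simp))
            z (by simp)) (ht _ (List.getLast?_eq_some_getLast (by simp)) z)
      · exact isSubgraph_of_infix h2.isInfix
    · have : D.Adj u h := by
        simp only [List.concat_eq_append, List.append_assoc, List.singleton_append,
          List.isChain_append_cons_cons] at hQ
        exact hQ.2.1
      exact absurd this (hs h (by simp) u)

end Acyclic

/-! ### Levels, heights and the lower bound. -/

section Levels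

variable {V : Type*}

/-- `Level D v k`: some walk from a source to `v` contains `k` arc-disjoint subwalks each of which
meets every identifying sequence of every maximal path continuing that walk. -/
inductive Level (D : Digraph V) : V → ℕ → Prop where
  | zero (v : V) : Level D v 0
  | indegree {u u' v : V} (hu : D.Adj u v) (hu' : D.Adj u' v) (hne : u ≠ u') : Level D v 1
  | route {x v : V} {k : ℕ} {l : List V} (hx : Level D x k) (hl : Route D.Adj x v l) : Level D v k
  | routes {x v : V} {k : ℕ} {l l' : List V} (hx : Level D x k) (hl : Route D.Adj x v l)
      (hl' : Route D.Adj x v l') (hne : l ≠ l') : Level D v (k + 1)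

/-- The out-degree of `v` is at least two. -/
def Branching (D : Digraph V) (v : V) : Prop := ∃ w w', D.Adj v w ∧ D.Adj v w' ∧ w ≠ w'

/-- The length of a longest walk ending in `v`. -/
noncomputable def height (D : Digraph V) (v : V) : ℕ :=
  sSup {k | ∃ l : List V, (l ++ [v]).IsChain D.Adj ∧ l.length = k}

variable {D : Digraph V} (hN : ∀ W : List V, W.IsChain D.Adj → W.Nodup)
include hN

section Height

variable [Fintype V]

theorem length_lt_card_of_isChain {l : List V} {v : V} (h : (l ++ [v]).IsChain D.Adj) :
    l.length < Fintype.card V := by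
  have := (hN _ h).length_le_card
  simp at this
  omega

theorem length_le_height {l : List V} {v : V} (h : (l ++ [v]).IsChain D.Adj) :
    l.length ≤ height D v := by
  refine le_csSup ⟨Fintype.card V, ?_⟩ ⟨l, h, rfl⟩
  rintro k ⟨l, hl, rfl⟩
  exact (length_lt_card_of_isChain hN hl).le

theorem exists_length_eq_height (v : V) :
    ∃ l : List V, (l ++ [v]).IsChain D.Adj ∧ l.length = height D v :=
  Nat.sSup_mem (s := {k | ∃ l : List V, (l ++ [v]).IsChain D.Adj ∧ l.length = k})
    ⟨0, [], by simp, rfl⟩ ⟨Fintype.card V, by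
      rintro k ⟨l, hl, rfl⟩
      exact (length_lt_card_of_isChain hN hl).le⟩

theorem height_lt_card (v : V) : height D v < Fintype.card V := by
  obtain ⟨l, hl, h⟩ := exists_length_eq_height hN v
  exact h ▸ length_lt_card_of_isChain hN hl

theorem height_add_length_le {x v : V} {l : List V} (h : Route D.Adj x v l) :
    height D x + l.length ≤ height D v := by
  obtain ⟨l', hl', h'⟩ := exists_length_eq_height hN x
  rw [← h', ← List.length_append]
  apply length_le_height hN
  obtain ⟨t, ht⟩ := h.exists_eq
  rw [List.append_assoc, ht, List.isChain_split]
  exact ⟨hl', ht ▸ h.1⟩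

theorem height_lt_of_adj {u v : V} (h : D.Adj u v) : height D u < height D v :=
  height_add_length_le hN (l := [u]) (by simpa [Route] using h)

/-- The last but one vertex of a longest walk is tight; this is the recursion behind `heightProg`.
-/
theorem exists_adj_of_height_ne_zero {v : V} (h : height D v ≠ 0) :
    ∃ u, D.Adj u v ∧ height D v = height D u + 1 := by
  obtain ⟨l, hl, h'⟩ := exists_length_eq_height hN v
  rcases List.eq_nil_or_concat l with rfl | ⟨l, u, rfl⟩
  · simp at h'; omega
  · simp only [List.concat_eq_append, List.append_assoc, List.singleton_append,
      List.isChain_append_cons_cons] at hl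
    have := length_le_height hN hl.1
    have := height_lt_of_adj hN hl.2.1
    simp at h'
    exact ⟨u, hl.2.1, by omega⟩

/-- Two distinct routes are not both empty, so each unit of level costs a step in height. Levels
therefore stay below `n` and fit into the machine words. -/
theorem Level.le_height {v : V} {k : ℕ} (h : Level D v k) : k ≤ height D v := by
  induction h with
  | zero v => simp
  | indegree hu hu' hne => exact (height_lt_of_adj hN hu).bot_lt
  | route hx hl ih => have := height_add_length_le hN hl; omega
  | @routes x v k l l' hx hl hl' hne ih =>
    have h1 := height_add_length_le hN hl
    have h2 := height_add_length_le hN hl'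
    rcases l with _ | ⟨a, l⟩
    · rcases l' with _ | ⟨a, l'⟩
      · exact absurd rfl hne
      · simp at h2; omega
    · simp at h1; omega

theorem exists_source_walk (v : V) :
    ∃ p : List V, (p ++ [v]).IsChain D.Adj ∧ ∀ x ∈ (p ++ [v]).head?, ∀ u, ¬ D.Adj u x := by
  obtain ⟨l, hl, h⟩ := exists_length_eq_height hN v
  refine ⟨l, hl, fun x hx u hu => ?_⟩
  have : (u :: l ++ [v]).IsChain D.Adj := by
    rw [List.cons_append, List.isChain_cons]
    exact ⟨fun y hy => by cases Option.mem_unique hx hy; exact hu, hl⟩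
  have := length_le_height hN this
  simp at this
  omega

theorem exists_sink_walk (v : V) :
    ∃ y : List V, (v :: y).IsChain D.Adj ∧ ∀ x ∈ (v :: y).getLast?, ∀ u, ¬ D.Adj x u := by
  -- Heights grow along arcs and are bounded by the number of vertices, so a walk cannot be extended
  -- forever.
  induction hk : Fintype.card V - height D v using Nat.strong_induction_on generalizing v with
  | _ k ih =>
    by_cases hv : ∃ w, D.Adj v w
    · obtain ⟨w, hw⟩ := hv
      have h1 := height_lt_of_adj hN hw
      have h2 := height_lt_card hN w
      obtain ⟨y, hy, hy'⟩ := ih _ (by omega) w rfl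
      refine ⟨w :: y, List.isChain_cons_cons.2 ⟨hw, hy⟩, ?_⟩
      rwa [List.getLast?_cons_cons]
    · push Not at hv
      exact ⟨[], by simp, by simpa using hv⟩

end Height

/-- A subgraph of a walk in which `(u', v)` replaces `(u, v)` is impossible. -/
theorem left_eq_of_isSubgraph {P Q : List V} {u u' v : V} (hP : P.IsChain D.Adj)
    (hQ : IsSubgraph Q P) (hu : (u, v) ∈ arcs P) (hu' : (u', v) ∈ arcs Q) : u = u' :=
  left_unique_of_mem_arcs (hN _ hP) hu (hQ.2 hu')

theorem right_eq_of_isSubgraph {P Q : List V} {u v v' : V} (hP : P.IsChain D.Adj)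
    (hQ : IsSubgraph Q P) (hv : (u, v) ∈ arcs P) (hv' : (u, v') ∈ arcs Q) : v = v' :=
  right_unique_of_mem_arcs (hN _ hP) hv (hQ.2 hv')

/-- Two routes between the same vertices with arcs on a common walk are equal. -/
theorem route_unique_of_arcs_subset {P l l' : List V} {x v : V} (hP : P.IsChain D.Adj)
    (hl : Route D.Adj x v l) (hl' : Route D.Adj x v l') (hlP : arcs (l ++ [v]) ⊆ arcs P)
    (hlP' : arcs (l' ++ [v]) ⊆ arcs P) : l = l' := by
  have key : ∀ {l l' : List V}, Route D.Adj x v l → Route D.Adj x v l' →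
      (l ++ [v]) <+: (l' ++ [v]) → l = l' := by
    rintro l l' hl hl' ⟨t, ht⟩
    rcases List.eq_nil_or_concat t with rfl | ⟨t, z, rfl⟩
    · simpa using ht
    · rw [List.concat_eq_append, ← List.append_assoc] at ht
      obtain ⟨h1, h2⟩ := List.append_inj' ht rfl
      have := hN _ hl'.1
      rw [← h1] at this
      simp only [List.append_assoc, List.singleton_append] at this
      exact absurd (by simp) (List.nodup_cons.1 (List.nodup_append.1 this).2.1).1
  obtain ⟨t, ht⟩ := hl.exists_eq
  obtain ⟨t', ht'⟩ := hl'.exists_eq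
  have h1 : (x :: t).IsChain (fun a b => (a, b) ∈ arcs P) :=
    ht ▸ (isChain_arcs _).imp fun a b hab => hlP hab
  have h2 : (x :: t').IsChain (fun a b => (a, b) ∈ arcs P) :=
    ht' ▸ (isChain_arcs _).imp fun a b hab => hlP' hab
  rcases prefix_or_prefix_of_isChain h1 h2 (fun a _ b c => right_unique_of_mem_arcs (hN _ hP))
    with h | h
  · rw [← ht, ← ht'] at h
    exact key hl hl' h
  · rw [← ht, ← ht'] at h
    exact (key hl' hl h).symm

omit hN in
theorem Route.isChain_append {p l y : List V} {x v : V} (hl : Route D.Adj x v l)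
    (hp : (p ++ [x]).IsChain D.Adj) (hy : (v :: y).IsChain D.Adj) :
    (p ++ (l ++ v :: y)).IsChain D.Adj := by
  obtain ⟨t, ht⟩ := hl.exists_eq
  have h1 : l ++ v :: y = x :: (t ++ y) := by
    rw [← List.cons_append, ← ht]; simp
  rw [h1, List.isChain_split]
  refine ⟨hp, ?_⟩
  rw [← h1, List.isChain_split]
  exact ⟨hl.1, hy⟩

omit hN in
theorem Route.arcs_append {p l : List V} {x v : V} (hl : Route D.Adj x v l) :
    arcs (p ++ (l ++ [v])) = arcs (p ++ [x]) ++ arcs (l ++ [v]) := by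
  obtain ⟨t, ht⟩ := hl.exists_eq
  rw [ht, EarAnonymity.arcs_append]

/-- Lower bound: a vertex of level `k` is reached by a walk from a source on which every
identifying sequence has at least `k` arcs. -/
theorem Level.exists_walk [Fintype V] {v : V} {k : ℕ} (h : Level D v k) :
    ∃ p : List V, (p ++ [v]).IsChain D.Adj ∧ (∀ x ∈ (p ++ [v]).head?, ∀ u, ¬ D.Adj u x) ∧
      ∀ (y : List V) (a a' : List (V × V)), (p ++ v :: y).IsChain D.Adj →
        a.Sublist (arcs (p ++ [v])) → a'.Sublist (arcs (v :: y)) →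
        (∀ Q, Q ≠ [] → Q.IsChain D.Adj → (a ++ a').Sublist (arcs Q) →
          IsSubgraph Q (p ++ v :: y)) → k ≤ a.length := by
  induction h with
  | zero v =>
    obtain ⟨p, hp, hp'⟩ := exists_source_walk hN v
    exact ⟨p, hp, hp', by simp⟩
  | @indegree u u' v hu hu' hne =>
    obtain ⟨p, hp, hp'⟩ := exists_source_walk hN u
    refine ⟨p ++ [u], ?_, ?_, fun y a a' hy ha ha' hQ => ?_⟩
    · simpa [List.isChain_append_cons_cons] using ⟨hp, hu⟩
    · cases p <;> simpa using hp'
    · rw [Nat.one_le_iff_ne_zero, Ne, List.length_eq_zero_iff]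
      -- Otherwise the walk that enters `v` from `u'` would contain the whole sequence.
      rintro rfl
      have hc : (u' :: v :: y).IsChain D.Adj :=
        List.isChain_cons_cons.2 ⟨hu', hy.suffix ⟨p ++ [u], by simp⟩⟩
      refine hne (left_eq_of_isSubgraph hN hy (hQ (u' :: v :: y) (by simp) hc ?_)
        (v := v) (mem_arcs_iff.2 ⟨p, y, by simp⟩) (by simp))
      rw [List.nil_append, arcs_cons_cons]
      exact ha'.cons _
  | @route x v k l hx hl ih =>
    obtain ⟨p, hp, hp', ih⟩ := ih
    have hl' := hl.isChain_append hp (y := []) (by simp)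
    refine ⟨p ++ l, by simpa using hl', ?_, fun y a a' hy ha ha' hQ => ?_⟩
    · obtain ⟨t, ht⟩ := hl.exists_eq
      rw [List.append_assoc, ht]
      cases p <;> simpa using hp'
    · obtain ⟨t, ht⟩ := hl.exists_eq
      have h1 : l ++ v :: y = x :: (t ++ y) := by rw [← List.cons_append, ← ht]; simp
      rw [List.append_assoc, hl.arcs_append] at ha
      rw [List.append_assoc, h1] at hy hQ
      obtain ⟨b, b', rfl, hb, hb'⟩ := List.sublist_append_iff.1 ha
      -- Seen from `x`, the arcs chosen on the route `l` belong to the continuation.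
      have := ih (t ++ y) b (b' ++ a') hy hb
        (by rw [← h1, EarAnonymity.arcs_append]; exact hb'.append ha')
        (by simpa using hQ)
      simp; omega
  | @routes x v k l l' hx hl hl' hne ih =>
    obtain ⟨p, hp, hp', ih⟩ := ih
    have hc := hl.isChain_append hp (y := []) (by simp)
    refine ⟨p ++ l, by simpa using hc, ?_, fun y a a' hy ha ha' hQ => ?_⟩
    · obtain ⟨t, ht⟩ := hl.exists_eq
      rw [List.append_assoc, ht]
      cases p <;> simpa using hp'
    · obtain ⟨t, ht⟩ := hl.exists_eq
      have h1 : l ++ v :: y = x :: (t ++ y) := by rw [← List.cons_append, ← ht]; simp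
      rw [List.append_assoc, hl.arcs_append] at ha
      rw [List.append_assoc] at hy hQ
      obtain ⟨b, b', rfl, hb, hb'⟩ := List.sublist_append_iff.1 ha
      have := ih (t ++ y) b (b' ++ a') (h1 ▸ hy) hb
        (by rw [← h1, EarAnonymity.arcs_append]; exact hb'.append ha')
        (by simpa [h1] using hQ)
      rw [List.length_append]
      suffices b' ≠ [] by
        have := List.length_pos_iff.2 this
        omega
      rintro rfl
      have hy' : (v :: y).IsChain D.Adj := hy.suffix ⟨p ++ l, by simp⟩
      -- With no arc chosen on `l`, the detour `l'` carries the same sequence, so it would be a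
      -- subgraph of the path and equal to `l`.
      have hsub := hQ (p ++ (l' ++ v :: y)) (by simp) (hl'.isChain_append hp hy') (by
        have : arcs (p ++ (l' ++ v :: y)) =
            arcs (p ++ [x]) ++ arcs (l' ++ [v]) ++ arcs (v :: y) := by
          rw [← hl'.arcs_append, ← List.append_assoc, EarAnonymity.arcs_append]; simp
        rw [this, List.append_nil]
        exact (List.Sublist.trans hb (by simp)).append ha')
      refine hne (route_unique_of_arcs_subset hN hy hl hl' ?_ ?_)
      · exact arcs_subset_of_infix ⟨p, y, by simp⟩
      · exact List.Subset.trans (arcs_subset_of_infix ⟨p, y, by simp⟩) hsub.2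

end Levels

/-! ### The greedy identifying sequence. -/

section UpperBound

variable {V : Type*} {D : Digraph V} (hN : ∀ W : List V, W.IsChain D.Adj → W.Nodup)
include hN

/-- The greedy choice of arcs on the rest `u :: y` of a path, once some arcs `a`, the last of
which has head `w`, have been chosen. -/
theorem exists_identifying_after {K : ℕ}
    (hK : ∀ v k, Level D v k → Branching D v → k + 1 ≤ K) (hK' : ∀ v k, Level D v k → k ≤ K)
    (y : List V) : ∀ (p l : List V) (w u : V) (a : List (V × V)),
      (∀ Q b, Q.IsChain D.Adj → (a ++ b).Sublist (arcs Q) →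
        ∃ q r, Q = q ++ w :: r ∧ q <:+ p ∧ b.Sublist (arcs (w :: r))) →
      Level D w a.length → Route D.Adj w u l → (∀ l', Route D.Adj w u l' → l' = l) →
      (u :: y).IsChain D.Adj → (∀ x ∈ (u :: y).getLast?, ∀ z, ¬ D.Adj x z) →
      ∃ b, (a ++ b).length ≤ K ∧ b.Sublist (arcs (l ++ u :: y)) ∧
        ∀ Q, Q.IsChain D.Adj → (a ++ b).Sublist (arcs Q) → Q <:+: p ++ (l ++ u :: y) := by
  induction y with
  | nil =>
    intro p l w u a ha hw hl huniq _ hsink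
    have hsink' : ∀ z, ¬ D.Adj u z := by simpa using hsink
    -- The sink is reached. A branching vertex after `w` inherits level `a.length` and so pays for
    -- one more arc; the last arc of the path then forces the unique route `l`.
    by_cases hbr : ∃ t ∈ l, Branching D t
    · obtain ⟨t, htl, ht⟩ := hbr
      obtain ⟨l1, l2, rfl⟩ := List.append_of_mem htl
      have hrt : Route D.Adj w t l1 := by
        refine ⟨hl.1.prefix ⟨l2 ++ [u], by simp⟩, ?_⟩
        have := hl.2
        cases l1 <;> simpa using this
      have hk := hK t _ (hw.route hrt) ht
      rcases List.eq_nil_or_concat (l1 ++ t :: l2) with h | ⟨l, u', h⟩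
      · simp at h
      rw [List.concat_eq_append] at h
      rw [h] at hl huniq ⊢
      refine ⟨[(u', u)], by simpa using hk, ?_, fun Q hQ hQa => ?_⟩
      · rw [List.singleton_sublist]
        exact mem_arcs_iff.2 ⟨l, [], by simp⟩
      · obtain ⟨q, r, rfl, hq, hr⟩ := ha Q _ hQ hQa
        obtain ⟨r1, r2, hr', -⟩ := exists_split_of_cons_sublist_arcs hr
        have hc : (w :: r).IsChain D.Adj := hQ.suffix ⟨q, rfl⟩
        rw [hr'] at hc ⊢
        have : Route D.Adj w u (r1 ++ [u']) := by
          refine ⟨hc.prefix ⟨r2, by simp⟩, ?_⟩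
          have := congrArg List.head? hr'
          cases r1 <;> simpa [eq_comm] using this
        have := huniq _ this
        rcases r2 with _ | ⟨z, r2⟩
        · obtain ⟨s, hs⟩ := hq
          refine ⟨s, [], ?_⟩
          rw [← this, ← hs]
          simp
        · refine absurd (hc.infix (l₁ := [u, z]) ⟨r1 ++ [u'], r2, by simp⟩) ?_
          simpa using hsink' z
    · push Not at hbr
      refine ⟨[], by simpa using hK' _ _ hw, by simp, fun Q hQ hQa => ?_⟩
      obtain ⟨q, r, rfl, ⟨s, rfl⟩, -⟩ := ha Q _ hQ hQa
      have hc : (w :: r).IsChain D.Adj := hQ.suffix ⟨q, rfl⟩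
      obtain ⟨t, ht⟩ := hl.exists_eq
      rw [ht]
      -- With no branching on `l`, a walk from `w` has no choice; it may only stop early, which
      -- still leaves an infix of the path.
      have hpre : (w :: r) <+: (w :: t) := by
        have hfun : ∀ x ∈ w :: t, ∀ b c, D.Adj x b → D.Adj x c → b = c := by
          intro x hx b c hb hc
          rw [← ht, List.mem_append, List.mem_singleton] at hx
          rcases hx with hx | rfl
          · by_contra hne
            exact hbr x hx ⟨b, c, hb, hc, hne⟩
          · exact absurd hb (hsink' b)
        rcases prefix_or_prefix_of_isChain (ht ▸ hl.1) hc hfun with h | h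
        · obtain ⟨e, he⟩ := h
          rcases e with _ | ⟨z, e⟩
          · exact ⟨[], by simp [← he]⟩
          · rw [← he, ← ht] at hc
            refine absurd (hc.infix (l₁ := [u, z]) ⟨l, e, by simp⟩) ?_
            simpa using hsink' z
        · exact h
      obtain ⟨e, he⟩ := hpre
      exact ⟨s, e, by simp [← he]⟩
  | cons z y ih =>
    intro p l w u a ha hw hl huniq hy hsink
    rw [List.isChain_cons_cons] at hy
    rw [List.getLast?_cons_cons] at hsink
    have hlz : Route D.Adj w z (l ++ [u]) := route_snoc.2 ⟨hl, hy.1⟩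
    -- While the route from `w` is unique no arc is spent. A second route gives `z` the level
    -- `a.length + 1`, which pays for `(u, z)`, and the scan restarts with `w = z` and the empty
    -- route.
    by_cases hz : ∀ l', Route D.Adj w z l' → l' = l ++ [u]
    · obtain ⟨b, h1, h2, h3⟩ := ih p (l ++ [u]) w z a ha hw hlz hz hy.2 hsink
      exact ⟨b, h1, by simpa using h2, by simpa using h3⟩
    · push Not at hz
      obtain ⟨l', hl', hne⟩ := hz
      obtain ⟨b, h1, h2, h3⟩ := ih (p ++ (l ++ [u])) [] z z (a ++ [(u, z)]) (by
          intro Q b hQ hQa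
          rw [List.append_assoc] at hQa
          obtain ⟨q, r, rfl, hq, hr⟩ := ha Q _ hQ hQa
          obtain ⟨r1, r2, hr', hb⟩ := exists_split_of_cons_sublist_arcs hr
          have hc : (w :: r).IsChain D.Adj := hQ.suffix ⟨q, rfl⟩
          rw [hr'] at hc ⊢
          have : Route D.Adj w u r1 := by
            refine ⟨hc.prefix ⟨z :: r2, by simp⟩, ?_⟩
            have := congrArg List.head? hr'
            cases r1 <;> simpa [eq_comm] using this
          rw [huniq _ this]
          obtain ⟨s, rfl⟩ := hq
          exact ⟨q ++ (l ++ [u]), r2, by simp, ⟨s, by simp⟩, hb⟩)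
        (by simpa using hw.routes hlz hl' hne.symm) (route_nil.2 rfl)
        (fun l' h => (route_self_iff hN).1 h) hy.2 hsink
      refine ⟨(u, z) :: b, by simpa using h1, ?_, fun Q hQ hQa => ?_⟩
      · rw [EarAnonymity.arcs_append, arcs_cons_cons]
        exact (List.Sublist.cons_cons _ h2).trans (by simp)
      · have := h3 Q hQ (by simpa using hQa)
        simpa using this

/-- The greedy choice of arcs on the rest `u :: y` of a path, as long as no arc is needed. -/
theorem exists_identifying_before {K : ℕ} (hK1 : 1 ≤ K)
    (hK : ∀ v k, Level D v k → Branching D v → k + 1 ≤ K) (hK' : ∀ v k, Level D v k → k ≤ K)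
    (y : List V) : ∀ (p : List V) (u : V), (∀ l, (l ++ [u]).IsChain D.Adj → l <:+ p) →
      (p ++ u :: y).IsChain D.Adj → p ++ y ≠ [] →
      (∀ x ∈ (u :: y).getLast?, ∀ z, ¬ D.Adj x z) →
      ∃ b, b ≠ [] ∧ b.length ≤ K ∧ b.Sublist (arcs (p ++ u :: y)) ∧
        ∀ Q, Q.IsChain D.Adj → b.Sublist (arcs Q) → Q <:+: p ++ u :: y := by
  induction y with
  | nil =>
    intro p u hp hc hne hsink
    have hsink' : ∀ z, ¬ D.Adj u z := by simpa using hsink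
    rcases List.eq_nil_or_concat p with rfl | ⟨p, u', rfl⟩
    · simp at hne
    rw [List.concat_eq_append] at *
    -- No arc was forced, but an identifying sequence has to be nonempty; the last arc does.
    refine ⟨[(u', u)], by simp, by simpa using hK1, ?_, fun Q hQ hQa => ?_⟩
    · rw [List.singleton_sublist]
      exact mem_arcs_iff.2 ⟨p, [], by simp⟩
    · obtain ⟨r1, r2, rfl, -⟩ := exists_split_of_cons_sublist_arcs hQa
      obtain ⟨s, hs⟩ := hp (r1 ++ [u']) (hQ.prefix ⟨r2, by simp⟩)
      rcases r2 with _ | ⟨z, r2⟩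
      · rw [← hs]
        exact ⟨s, [], by simp⟩
      · refine absurd (hQ.infix (l₁ := [u, z]) ⟨r1 ++ [u'], r2, by simp⟩) ?_
        simpa using hsink' z
  | cons z y ih =>
    intro p u hp hc hne hsink
    have hy := List.isChain_append_cons_cons.1 hc
    rw [List.getLast?_cons_cons] at hsink
    by_cases hz : ∀ l, (l ++ [z]).IsChain D.Adj → l <:+ p ++ [u]
    · simpa using ih (p ++ [u]) z hz (by simpa using hc) (by simp) hsink
    · push Not at hz
      obtain ⟨l, hl, hls⟩ := hz
      have hlev : Level D z 1 := by
        rcases List.eq_nil_or_concat l with rfl | ⟨l, u', rfl⟩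
        · simp at hls
        · simp only [List.concat_eq_append, List.append_assoc, List.singleton_append,
            List.isChain_append_cons_cons] at hl hls
          refine .indegree hy.2.1 hl.2.1 ?_
          rintro rfl
          obtain ⟨s, rfl⟩ := hp l hl.1
          exact hls ⟨s, by simp⟩
      obtain ⟨b, h1, h2, h3⟩ := exists_identifying_after hN hK hK' y (p ++ [u]) [] z z [(u, z)] (by
          intro Q b hQ hQa
          obtain ⟨r1, r2, rfl, hb⟩ := exists_split_of_cons_sublist_arcs hQa
          obtain ⟨s, rfl⟩ := hp r1 (hQ.prefix ⟨z :: r2, by simp⟩)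
          exact ⟨r1 ++ [u], r2, by simp, ⟨s, by simp⟩, hb⟩)
        (by simpa using hlev) (route_nil.2 rfl)
        (fun l' h => (route_self_iff hN).1 h) hy.2.2 hsink
      refine ⟨(u, z) :: b, by simp, by simpa using h1, ?_, fun Q hQ hQa => ?_⟩
      · rw [EarAnonymity.arcs_append, arcs_cons_cons]
        exact (List.Sublist.cons_cons _ h2).trans (by simp)
      · have := h3 Q hQ (by simpa using hQa)
        simpa using this

end UpperBound

/-! ### The anonymity in terms of levels. -/

section Anonymity

variable {V : Type*} {D : Digraph V}

theorem anonOfEar_le {P : List V} {a : List (V × V)} (ha : IsIdentifyingSequence D P a) :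
    anonOfEar D P ≤ a.length := by
  unfold anonOfEar
  split_ifs
  · simp
  · exact Nat.sInf_le ⟨a, ha, rfl⟩

theorem le_anonOfEar {P : List V} {k : ℕ} (hP : arcs P ≠ [])
    (hne : ∃ a, IsIdentifyingSequence D P a)
    (h : ∀ a, IsIdentifyingSequence D P a → k ≤ a.length) : k ≤ anonOfEar D P := by
  rw [anonOfEar, if_neg hP]
  obtain ⟨a, ha⟩ := hne
  refine le_csInf ⟨_, a, ha, rfl⟩ ?_
  rintro _ ⟨a, ha, rfl⟩
  exact h a ha

theorem anon_eq_zero (hD : ∀ u v, ¬ D.Adj u v) : anon D = 0 := by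
  have : ∀ P, IsMaximalEar D P → anonOfEar D P = 0 := by
    intro P hP
    have hc : P.IsChain D.Adj := by
      rcases hP.1 with h | h
      · exact h.1.2
      · exact h.1.2
    rw [anonOfEar, if_pos]
    rw [List.eq_nil_iff_forall_not_mem]
    rintro ⟨a, b⟩ hab
    exact hD a b (isChain_iff_arcs.1 hc a b hab)
  rw [anon, ← Nat.le_zero]
  refine csSup_le' ?_
  rintro _ ⟨P, hP, rfl⟩
  exact (this P hP).le

variable [Fintype V] (hN : ∀ W : List V, W.IsChain D.Adj → W.Nodup)
include hN

omit [Fintype V] in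
theorem exists_identifying {K : ℕ} (hK1 : 1 ≤ K)
    (hK : ∀ v k, Level D v k → Branching D v → k + 1 ≤ K) (hK' : ∀ v k, Level D v k → k ≤ K)
    {P : List V} (hP : IsMaximalEar D P) (hne : arcs P ≠ []) :
    ∃ a, IsIdentifyingSequence D P a ∧ a.length ≤ K := by
  obtain ⟨h1, h2, h3, h4⟩ := (isMaximalEar_iff hN).1 hP
  obtain ⟨u, y, rfl⟩ := List.exists_cons_of_ne_nil h1
  obtain ⟨b, hb, hbK, hbs, hQ⟩ := exists_identifying_before hN hK1 hK hK' y [] u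
    (fun l hl => by
      rcases List.eq_nil_or_concat l with rfl | ⟨l, u', rfl⟩
      · simp
      · simp only [List.concat_eq_append, List.append_assoc, List.singleton_append,
          List.isChain_append_cons_cons] at hl
        exact absurd hl.2.1 (h3 u (by simp) u')) h2 (by
      rintro h
      rw [List.nil_append] at h
      simp [h] at hne) h4
  exact ⟨b, ⟨hb, hbs, fun Q hQe hbQ =>
    isSubgraph_of_infix (hQ Q ((isEar_iff_of_nodup hN).1 hQe).2 hbQ)⟩, hbK⟩

/-- The ear anonymity of an acyclic digraph with an arc is the maximum of `1`, of the levels of the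
vertices, and of the levels increased by one of the branching vertices. -/
theorem anon_eq_of_level (harc : ∃ u v, D.Adj u v) {K : ℕ} (hK1 : 1 ≤ K)
    (hK : ∀ v k, Level D v k → Branching D v → k + 1 ≤ K) (hK' : ∀ v k, Level D v k → k ≤ K)
    (hatt : K = 1 ∨ (∃ v, Level D v K) ∨ ∃ v k, Level D v k ∧ Branching D v ∧ K = k + 1) :
    anon D = K := by
  apply le_antisymm
  · refine csSup_le' ?_
    rintro _ ⟨P, hP, rfl⟩
    by_cases hne : arcs P = []
    · rw [anonOfEar, if_pos hne]; simp
    · obtain ⟨a, ha, haK⟩ := exists_identifying hN hK1 hK hK' hP hne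
      exact (anonOfEar_le ha).trans haK
  · suffices ∃ P, IsMaximalEar D P ∧ arcs P ≠ [] ∧
        ∀ a, IsIdentifyingSequence D P a → K ≤ a.length by
      obtain ⟨P, hP, hne, h⟩ := this
      obtain ⟨a, ha, -⟩ := exists_identifying hN hK1 hK hK' hP hne
      exact (le_anonOfEar hne ⟨a, ha⟩ h).trans
        (le_csSup (bddAbove_anonOfEar D) ⟨P, hP, rfl⟩)
    have hmax : ∀ {p : List V} {v : V} {y : List V}, (p ++ [v]).IsChain D.Adj →
        (∀ x ∈ (p ++ [v]).head?, ∀ u, ¬ D.Adj u x) → (v :: y).IsChain D.Adj →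
        (∀ x ∈ (v :: y).getLast?, ∀ u, ¬ D.Adj x u) → IsMaximalEar D (p ++ v :: y) := by
      intro p v y h1 h2 h3 h4
      refine (isMaximalEar_iff hN).2 ⟨by simp, List.isChain_split.2 ⟨h1, h3⟩, ?_, ?_⟩
      · cases p <;> simpa using h2
      · rwa [List.getLast?_append_of_ne_nil _ (by simp)]
    have hone : K = 1 → ∃ P, IsMaximalEar D P ∧ arcs P ≠ [] ∧
        ∀ a, IsIdentifyingSequence D P a → K ≤ a.length := by
      rintro rfl
      obtain ⟨u, v, huv⟩ := harc
      obtain ⟨p, hp, hp'⟩ := exists_source_walk hN u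
      obtain ⟨y, hy, hy'⟩ := exists_sink_walk hN v
      refine ⟨p ++ u :: v :: y, hmax hp hp' (List.isChain_cons_cons.2 ⟨huv, hy⟩)
        (by rwa [List.getLast?_cons_cons]), ?_, fun a ha => List.length_pos_iff.2 ha.1⟩
      rw [arcs_append]
      simp
    have hlev : ∀ {v k}, Level D v k → ∃ p : List V, (p ++ [v]).IsChain D.Adj ∧
        (∀ x ∈ (p ++ [v]).head?, ∀ u, ¬ D.Adj u x) ∧ ∀ y, (v :: y).IsChain D.Adj → 
        ∀ a, IsIdentifyingSequence D (p ++ v :: y) a → ∃ b b', a = b ++ b' ∧ k ≤ b.length ∧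
          b.Sublist (arcs (p ++ [v])) ∧ b'.Sublist (arcs (v :: y)) := by
      intro v k h
      obtain ⟨p, hp, hp', h⟩ := h.exists_walk hN
      refine ⟨p, hp, hp', fun y hy a ha => ?_⟩
      have h1 := ha.2.1
      rw [arcs_append, List.sublist_append_iff] at h1
      obtain ⟨b, b', rfl, hb, hb'⟩ := h1
      exact ⟨b, b', rfl, h y b b' (List.isChain_split.2 ⟨hp, hy⟩) hb hb'
        fun Q h1 h2 => ha.2.2 Q ((isEar_iff_of_nodup hN).2 ⟨h1, h2⟩), hb, hb'⟩
    rcases hatt with h | ⟨v, h⟩ | ⟨v, k, h, ⟨w, w', hw, hw', hne⟩, rfl⟩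
    · exact hone h
    · by_cases hK2 : K = 1
      · exact hone hK2
      obtain ⟨p, hp, hp', hb⟩ := hlev h
      obtain ⟨y, hy, hy'⟩ := exists_sink_walk hN v
      have key : ∀ a, IsIdentifyingSequence D (p ++ v :: y) a → K ≤ a.length := by
        intro a ha
        obtain ⟨b, b', rfl, h1, -⟩ := hb y hy a ha
        rw [List.length_append]
        omega
      have hP := hmax hp hp' hy hy'
      refine ⟨p ++ v :: y, hP, fun h0 => ?_, key⟩
      have hle := h.le_height hN
      obtain ⟨u, hu, -⟩ := exists_adj_of_height_ne_zero hN (v := v) (by omega)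
      rcases List.eq_nil_or_concat p with rfl | ⟨p, u', rfl⟩
      · exact hp' v (by simp) u hu
      · have : (u', v) ∈ arcs (p.concat u' ++ v :: y) := mem_arcs_iff.2 ⟨p, y, by simp⟩
        rw [h0] at this
        simp at this
    · obtain ⟨p, hp, hp', hb⟩ := hlev h
      obtain ⟨y, hy, hy'⟩ := exists_sink_walk hN w
      have hvy : (v :: w :: y).IsChain D.Adj := List.isChain_cons_cons.2 ⟨hw, hy⟩
      refine ⟨p ++ v :: w :: y, hmax hp hp' hvy (by rwa [List.getLast?_cons_cons]), ?_,
        fun a ha => ?_⟩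
      · rw [arcs_append]; simp
      · obtain ⟨b, b', rfl, h1, h2, h3⟩ := hb _ hvy a ha
        rw [List.length_append]
        suffices b' ≠ [] by
          have := List.length_pos_iff.2 this
          omega
        -- Without an arc after `v`, the path that turns off to `w'` would contain the whole
        -- sequence.
        rintro rfl
        have hc : (p ++ [v, w']).IsChain D.Adj :=
          List.isChain_append_cons_cons.2 ⟨hp, hw', by simp⟩
        have hsub := ha.2.2 (p ++ [v, w']) ((isEar_iff_of_nodup hN).2 ⟨by simp, hc⟩) (by
          rw [arcs_append, List.append_nil]
          exact h2.trans (by simp))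
        exact hne (right_eq_of_isSubgraph hN (u := v) (List.isChain_split.2 ⟨hp, hvy⟩) hsub
          (mem_arcs_iff.2 ⟨p, y, by simp⟩) (mem_arcs_iff.2 ⟨p, [], by simp⟩))

end Anonymity

/-! ### Correctness and running time of programs. -/

section ProgramLogic

/-- The state with the value `x` written to register `i`. -/
def State.setReg (s : State) (i x : ℕ) : State := ⟨Function.update s.reg i x, s.mem⟩

/-- The state with the value `x` written to cell `j` of array `a`. -/
def State.setMem (s : State) (a j x : ℕ) : State :=
  ⟨s.reg, Function.update s.mem a (Function.update (s.mem a) j x)⟩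

@[simp] theorem State.reg_setReg (s : State) (i x j : ℕ) :
    (s.setReg i x).reg j = if j = i then x else s.reg j := by
  simp [State.setReg, Function.update_apply]

@[simp] theorem State.mem_setReg (s : State) (i x : ℕ) : (s.setReg i x).mem = s.mem := rfl

@[simp] theorem State.reg_setMem (s : State) (a j x : ℕ) : (s.setMem a j x).reg = s.reg := rfl

@[simp] theorem State.mem_setMem (s : State) (a j x b k : ℕ) :
    (s.setMem a j x).mem b k = if b = a ∧ k = j then x else s.mem b k := by
  simp only [State.setMem, Function.update_apply]
  by_cases hb : b = a
  · subst hb; simp [Function.update_apply]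
  · simp [hb]

/-- The weakest precondition of a program without loops. -/
def Prog.wp (B : ℕ) : Prog → (State → Prop) → State → Prop
  | .skip, Q, s => Q s
  | .set i e, Q, s => e.eval s ≤ B ∧ Q (s.setReg i (e.eval s))
  | .put a e f, Q, s => e.eval s ≤ B ∧ f.eval s ≤ B ∧ Q (s.setMem a (e.eval s) (f.eval s))
  | .seq p q, Q, s => p.wp B (q.wp B Q) s
  | .ite e p q, Q, s => (e.eval s ≠ 0 → p.wp B Q s) ∧ (e.eval s = 0 → q.wp B Q s)
  | .while _ _, _, _ => False

/-- An upper bound for the number of steps of a program without loops. -/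
def Prog.bound : Prog → ℕ
  | .skip => 1
  | .set _ e => e.cost + 1
  | .put _ e f => e.cost + f.cost + 1
  | .seq p q => p.bound + q.bound
  | .ite e p q => e.cost + 1 + (p.bound + q.bound)
  | .while _ _ => 0

/-- Started in `s`, the program `p` halts after at most `T` steps in a state with property `Q`. -/
def Runs (B : ℕ) (p : Prog) (s : State) (T : ℕ) (Q : State → Prop) : Prop :=
  ∃ t s', Exec B p s t s' ∧ t ≤ T ∧ Q s'

theorem Runs.of_wp {B : ℕ} {p : Prog} {s : State} {Q : State → Prop} (h : p.wp B Q s) :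
    Runs B p s p.bound Q := by
  induction p generalizing s Q with
  | skip => exact ⟨_, _, .skip s, le_rfl, h⟩
  | set i e => exact ⟨_, _, .set s i e h.1, le_rfl, h.2⟩
  | put a e f => exact ⟨_, _, .put s a e f h.1 h.2.1, le_rfl, h.2.2⟩
  | seq p q ihp ihq =>
    obtain ⟨t, s', hs', ht, h⟩ := ihp h
    obtain ⟨t', s'', hs'', ht', h⟩ := ihq h
    exact ⟨_, _, .seq hs' hs'', Nat.add_le_add ht ht', h⟩
  | ite e p q ihp ihq =>
    by_cases he : e.eval s = 0
    · obtain ⟨t, s', hs', ht, h⟩ := ihq (h.2 he)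
      exact ⟨_, _, .iteFalse he hs', by simp only [Prog.bound]; omega, h⟩
    · obtain ⟨t, s', hs', ht, h⟩ := ihp (h.1 he)
      exact ⟨_, _, .iteTrue he hs', by simp only [Prog.bound]; omega, h⟩
  | _ => exact h.elim

variable {B : ℕ} {p q : Prog} {s : State} {T T' : ℕ} {Q Q' : State → Prop}

theorem Runs.mono (h : Runs B p s T Q) (hT : T ≤ T') (hQ : ∀ s', Q s' → Q' s') :
    Runs B p s T' Q' := by
  obtain ⟨t, s', h1, h2, h3⟩ := h
  exact ⟨t, s', h1, h2.trans hT, hQ s' h3⟩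

theorem Runs.seq (hp : Runs B p s T Q) (hq : ∀ s', Q s' → Runs B q s' T' Q') :
    Runs B (.seq p q) s (T + T') Q' := by
  obtain ⟨t, s', h1, h2, h3⟩ := hp
  obtain ⟨t', s'', h1', h2', h3'⟩ := hq s' h3
  exact ⟨_, _, .seq h1 h1', Nat.add_le_add h2 h2', h3'⟩

/-- `loop i r p` executes `p` with the values `0, …, reg r - 1` in register `i`. -/
def loop (i r : ℕ) (p : Prog) : Prog :=
  .seq (.set i (.const 0))
    (.while (.lt (.reg i) (.reg r)) (.seq p (.set i (.add (.reg i) (.const 1)))))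

/-- The overhead `8` is the test and the increment, `4` each; `6` is the initialisation and the
final failing test. The counter advances after the body, hence the invariant at `s'.setReg i (k +
1)`. -/
theorem Runs.loop {i r K : ℕ} (hir : i ≠ r) (Inv : ℕ → State → Prop) (hK : K ≤ B)
    (hr : s.reg r = K) (h0 : Inv 0 (s.setReg i 0))
    (hstep : ∀ k s, k < K → s.reg i = k → s.reg r = K → Inv k s →
      Runs B p s T (fun s' => s'.reg i = k ∧ s'.reg r = K ∧ Inv (k + 1) (s'.setReg i (k + 1)))) :
    Runs B (loop i r p) s (K * (T + 8) + 6) (fun s' => s'.reg r = K ∧ Inv K s') := by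
  have hw : ∀ d k s, k + d = K → s.reg i = k → s.reg r = K → Inv k s →
      Runs B (.while (.lt (.reg i) (.reg r)) (.seq p (.set i (.add (.reg i) (.const 1))))) s
        (d * (T + 8) + 4) (fun s' => s'.reg r = K ∧ Inv K s') := by
    intro d
    induction d with
    | zero =>
      rintro k s rfl hi hr hI
      exact ⟨_, s, .whileFalse (by simp [Expr.eval, hi, hr]), by simp [Expr.cost], hr, hI⟩
    | succ d ih =>
      intro k s hk hi hr hI
      obtain ⟨t, s', h1, h2, h3, h4, h5⟩ := hstep k s (by omega) hi hr hI
      obtain ⟨t', s'', h1', h2', h3'⟩ := ih (k + 1) (s'.setReg i (k + 1)) (by omega) (by simp)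
        (by simp [hir.symm, h4]) h5
      have h6 : Exec B (.set i (.add (.reg i) (.const 1))) s' 4 (s'.setReg i (k + 1)) := by
        have := Exec.set (B := B) s' i (.add (.reg i) (.const 1))
          (by simp [Expr.eval, h3]; omega)
        simpa [Expr.eval, Expr.cost, h3, State.setReg] using this
      refine ⟨_, s'', .whileTrue (by simp [Expr.eval, hi, hr]; omega) (.seq h1 h6) h1', ?_, h3'⟩
      simp only [Expr.cost]
      linarith
  have h1 : Exec B (.set i (.const 0)) s 2 (s.setReg i 0) := .set s i (.const 0) (by simp [Expr.eval])
  obtain ⟨t', s'', h1', h2', h3'⟩ := hw K 0 (s.setReg i 0) (by simp) (by simp)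
    (by simp [hir.symm, hr]) h0
  exact ⟨_, _, .seq h1 h1', by omega, h3'⟩

end ProgramLogic

/-! ### Computing heights and sorting the arcs. -/

section Sorting

variable {n : ℕ}

/-- Arrays `a` and `b` hold the tails and the heads of the arcs in the list `S`. -/
def HoldsArcs (a b : ℕ) (S : List (Fin n × Fin n)) (s : State) : Prop :=
  ∀ j (hj : j < S.length), s.mem a j = S[j].1 ∧ s.mem b j = S[j].2

/-- The input is still in place. -/
def HoldsInput (L : List (Fin n × Fin n)) (s : State) : Prop :=
  s.reg 0 = n ∧ s.reg 1 = L.length ∧ HoldsArcs 0 1 L s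

theorem mem_take_succ_iff {α : Type*} {L : List α} {j : ℕ} (hj : j < L.length) {a : α} :
    a ∈ L.take (j + 1) ↔ a ∈ L.take j ∨ a = L[j] := by
  rw [List.take_succ_eq_append_getElem hj, List.mem_append, List.mem_singleton]

theorem getElem_notMem_take {α : Type*} {L : List α} (hL : L.Nodup) {j : ℕ} (hj : j < L.length) :
    L[j] ∉ L.take j := by
  intro h
  obtain ⟨i, hi, h'⟩ := List.mem_take_iff_getElem.1 h
  have := (hL.getElem_inj_iff).1 h'
  omega

/-- Stores the heights of the vertices in array `2`. -/
def heightProg : Prog :=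
  loop 2 0 (loop 3 1
    (.ite (.lt (.get 2 (.get 1 (.reg 3))) (.add (.get 2 (.get 0 (.reg 3))) (.const 1)))
      (.put 2 (.get 1 (.reg 3)) (.add (.get 2 (.get 0 (.reg 3))) (.const 1)))
      .skip))

/-- Array `2` holds the heights. -/
def HoldsHeight (D : Digraph (Fin n)) (s : State) : Prop := ∀ v : Fin n, s.mem 2 v = height D v

variable {D : Digraph (Fin n)} {L : List (Fin n × Fin n)} {B : ℕ}
  (hN : ∀ W : List (Fin n), W.IsChain D.Adj → W.Nodup) (hL : IsArcList D L)
  (hB : n + L.length + 2 ≤ B)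
include hN hL hB

/-- Bellman–Ford relaxation: values never exceed the heights, and after `r` rounds they are correct
up to truncation at `r`. As heights are below `n`, `n` rounds suffice. -/
theorem runs_heightProg {s : State} (hs : HoldsInput L s) (h0 : ∀ a j, 1 < a → s.mem a j = 0) :
    Runs B heightProg s (n * (L.length * 40 + 14) + 6)
      (fun s' => HoldsInput L s' ∧ HoldsHeight D s' ∧ ∀ a j, 2 < a → s'.mem a j = 0) := by
  let P : ℕ → State → Prop := fun r s => HoldsInput L s ∧ (∀ a j, 2 < a → s.mem a j = 0) ∧
    ∀ v : Fin n, min r (height D v) ≤ s.mem 2 v ∧ s.mem 2 v ≤ height D v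
  let I : ℕ → ℕ → State → Prop := fun r j s => P r s ∧ s.reg 2 = r ∧
    ∀ i (hi : i < L.length), i < j → min (r + 1) (height D L[i].1 + 1) ≤ s.mem 2 L[i].2
  have hadj : ∀ i (hi : i < L.length), height D L[i].1 < height D L[i].2 := fun i hi =>
    height_lt_of_adj hN ((hL.2 _ _).1 (List.getElem_mem hi))
  have hlt : ∀ v : Fin n, height D v < n := fun v => by simpa using height_lt_card hN v
  refine (Runs.loop (by decide) P (by omega) hs.1 ?_ ?_).mono (T' := n * (L.length * 40 + 14) + 6)
    le_rfl ?_
  · refine ⟨by simpa [HoldsInput, HoldsArcs] using hs, fun a j ha => h0 a j (by omega), fun v => ?_⟩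
    simp [h0]
  · intro r s hr hi hn hP
    refine (Runs.loop (by decide) (I r) (by omega) hP.1.2.1 ?_ ?_).mono le_rfl ?_
    · exact ⟨by simpa [P, HoldsInput, HoldsArcs] using hP, by simpa using hi, by simp⟩
    · intro j s hj hi' hm hI
      obtain ⟨⟨hs, hz, hv⟩, hr', hI⟩ := hI
      obtain ⟨h1, h2⟩ := hs.2.2 j hj
      have ha := hadj j hj
      have hb := hlt L[j].2
      have hv1 := hv L[j].1
      have hv2 := hv L[j].2
      refine (Runs.of_wp ?_).mono (show _ ≤ 32 by decide) (fun _ h => h)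
      simp only [Prog.wp, Expr.eval, hi', h1, h2]
      constructor
      · intro hc
        have hc' : s.mem 2 L[j].2 < s.mem 2 L[j].1 + 1 := by
          by_contra h; simp [h] at hc
        refine ⟨by omega, by omega, by simpa using hi', by simpa using hm,
          ⟨⟨?_, ?_, fun v => ?_⟩, ?_, fun i hi hij => ?_⟩⟩
        · simpa [HoldsInput, HoldsArcs] using hs
        · intro a k ha
          simp [show a ≠ 2 by omega, hz a k ha]
        · simp only [State.mem_setReg, State.mem_setMem, true_and, Fin.val_inj]
          split_ifs with h
          · subst h; omega
          · exact hv v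
        · simpa using hr'
        · simp only [State.mem_setReg, State.mem_setMem, true_and, Fin.val_inj]
          split_ifs with h
          · rcases Nat.lt_succ_iff_lt_or_eq.1 hij with hij | rfl
            · have := hI i hi hij
              rw [h] at this
              omega
            · omega
          · rcases Nat.lt_succ_iff_lt_or_eq.1 hij with hij | rfl
            · exact hI i hi hij
            · exact absurd rfl h
      · intro hc
        have hc' : ¬ s.mem 2 L[j].2 < s.mem 2 L[j].1 + 1 := by
          intro h; simp [h] at hc
        refine ⟨trivial, hm, ⟨⟨?_, ?_, fun v => ?_⟩, ?_, fun i hi hij => ?_⟩⟩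
        · simpa [HoldsInput, HoldsArcs] using hs
        · simpa using hz
        · simpa using hv v
        · simpa using hr'
        · rw [State.mem_setReg]
          rcases Nat.lt_succ_iff_lt_or_eq.1 hij with hij | rfl
          · exact hI i hi hij
          · omega
    · rintro s' ⟨hm, ⟨hs, hz, hv⟩, hr', hI⟩
      refine ⟨hr', hs.1, by simpa [HoldsInput, HoldsArcs] using hs, by simpa using hz, fun v => ?_⟩
      rw [State.mem_setReg]
      refine ⟨?_, (hv v).2⟩
      by_cases h : height D v = 0
      · simp [h]
      · obtain ⟨u, hu, hh⟩ := exists_adj_of_height_ne_zero hN h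
        obtain ⟨i, hi, hi'⟩ := List.getElem_of_mem ((hL.2 u v).2 hu)
        have := hI i hi hi
        rw [hi'] at this
        simpa [hh] using this
  · rintro s' ⟨-, hs, hz, hv⟩
    refine ⟨hs, fun v => ?_, hz⟩
    have := hv v
    have := hlt v
    omega

/-- Stores the arcs in the order of the heights of their tails in arrays `3` and `4`. -/
def sortProg : Prog :=
  .seq (.set 4 (.const 0))
    (loop 2 0 (loop 3 1
      (.ite (.eq (.get 2 (.get 0 (.reg 3))) (.reg 2))
        (.seq (.put 3 (.reg 4) (.get 0 (.reg 3)))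
          (.seq (.put 4 (.reg 4) (.get 1 (.reg 3)))
            (.set 4 (.add (.reg 4) (.const 1)))))
        .skip)))

/-- `S` lists the arcs in the order of the heights of their tails. -/
def IsSortedArcList (D : Digraph (Fin n)) (S : List (Fin n × Fin n)) : Prop :=
  IsArcList D S ∧ S.Pairwise fun a b => height D a.1 ≤ height D b.1

theorem runs_sortProg {s : State} (hs : HoldsInput L s) (hh : HoldsHeight D s)
    (h0 : ∀ a j, 2 < a → s.mem a j = 0) :
    Runs B sortProg s (n * (L.length * 40 + 14) + 8)
      (fun s' => HoldsInput L s' ∧ (∃ S, IsSortedArcList D S ∧ S.length = L.length ∧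
        HoldsArcs 3 4 S s') ∧ ∀ a j, 4 < a → s'.mem a j = 0) := by
  let P : (Fin n × Fin n → Prop) → State → Prop := fun M s => HoldsInput L s ∧ HoldsHeight D s ∧
    (∀ a j, 4 < a → s.mem a j = 0) ∧ ∃ S, HoldsArcs 3 4 S s ∧ S.length = s.reg 4 ∧ S.Nodup ∧
      S.Pairwise (fun a b => height D a.1 ≤ height D b.1) ∧ ∀ a, a ∈ S ↔ M a
  have hP : ∀ M s i x, i = 2 ∨ i = 3 → P M s → P M (s.setReg i x) := by
    intro M s i x hi h
    rcases hi with rfl | rfl <;> simpa [P, HoldsInput, HoldsArcs, HoldsHeight] using h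
  -- The arcs output once round `r` has inspected `j` arcs: round `r` appends those with tail of
  -- height `r`.
  let M : ℕ → ℕ → Fin n × Fin n → Prop := fun r j a =>
    (a ∈ L ∧ height D a.1 < r) ∨ (a ∈ L.take j ∧ height D a.1 = r)
  have hlt : ∀ v : Fin n, height D v < n := fun v => by simpa using height_lt_card hN v
  have hlen : ∀ S : List (Fin n × Fin n), S.Nodup → (∀ a ∈ S, a ∈ L) → S.length ≤ L.length :=
    fun S hS hSL => (List.subperm_of_subset hS hSL).length_le
  rw [show n * (L.length * 40 + 14) + 8 = 2 + (n * (L.length * 40 + 14) + 6) by ring]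
  refine Runs.seq (Q := fun s => P (M 0 0) s) (Runs.of_wp ?_) fun s hs => ?_
  · simp only [Prog.wp, Expr.eval]
    refine ⟨by simp, by simpa [HoldsInput, HoldsArcs] using hs, by simpa [HoldsHeight] using hh,
      fun a j ha => h0 a j (by omega), [], by simp [HoldsArcs], by simp, by simp, by simp, ?_⟩
    simp [M]
  refine (Runs.loop (by decide) (fun r => P (M r 0)) (by omega) hs.1.1 ?_ ?_).mono
    (T' := n * (L.length * 40 + 14) + 6) le_rfl ?_
  · exact hP _ _ _ _ (.inl rfl) hs
  · intro r s hr hi hn hs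
    refine (Runs.loop (by decide) (fun j s => s.reg 2 = r ∧ P (M r j) s) (by omega)
      hs.1.2.1 ?_ ?_).mono le_rfl ?_
    · exact ⟨by simpa using hi, hP _ _ _ _ (.inr rfl) hs⟩
    · rintro j s hj hi' hm ⟨hr', hs, hh, hz, S, hS, hSl, hSn, hSs, hSm⟩
      obtain ⟨h1, h2⟩ := hs.2.2 j hj
      refine (Runs.of_wp ?_).mono (show _ ≤ 32 by decide) (fun _ h => h)
      simp only [Prog.wp, Expr.eval, hi', h1, hh L[j].1, hr']
      constructor
      · intro hc
        have hc' : height D L[j].1 = r := by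
          by_contra h; simp [h] at hc
        have hnot : L[j] ∉ S := by
          rw [hSm]
          rintro (h | h)
          · omega
          · exact getElem_notMem_take hL.1 hj h.1
        have hSn' : (S ++ [L[j]]).Nodup := by
          rw [List.nodup_append]
          refine ⟨hSn, by simp, ?_⟩
          rintro a ha b hb rfl
          rw [List.mem_singleton] at hb
          exact hnot (hb ▸ ha)
        -- The output has no repetition, so the write index stays within the word bound.
        have hle : S.length + 1 ≤ L.length := by
          have := hlen _ hSn' (by
            intro a ha
            rw [List.mem_append, hSm, List.mem_singleton] at ha
            rcases ha with (h | h) | rfl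
            · exact h.1
            · exact List.mem_of_mem_take h.1
            · exact List.getElem_mem hj)
          simpa using this
        have hv1 := L[j].1.isLt
        have hv2 := L[j].2.isLt
        have hm0 : ∀ k, (s.setMem 3 (s.reg 4) L[j].1).mem 0 k = s.mem 0 k := by simp
        have hm1 : ∀ k, (s.setMem 3 (s.reg 4) L[j].1).mem 1 k = s.mem 1 k := by simp
        simp only [State.reg_setMem, hi', hm1, h2]
        refine ⟨by omega, by omega, by omega, by omega, by omega, by simpa using hi',
          by simpa using hm, by simpa using hr', ?_, ?_, ?_, S ++ [L[j]], ?_, ?_, hSn', ?_, ?_⟩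
        · simpa [HoldsInput, HoldsArcs] using hs
        · simpa [HoldsHeight] using hh
        · intro a k ha
          simp [show a ≠ 3 by omega, show a ≠ 4 by omega, hz a k ha]
        · intro k hk
          rw [List.length_append, List.length_singleton] at hk
          rcases Nat.lt_succ_iff_lt_or_eq.1 hk with hk' | rfl
          · have := hS k hk'
            rw [List.getElem_append_left hk']
            simpa [show k ≠ s.reg 4 by omega] using this
          · simp [hSl]
        · simp [hSl]
        · rw [List.pairwise_append]
          refine ⟨hSs, by simp, fun a ha b hb => ?_⟩
          rw [List.mem_singleton] at hb
          rw [hb, hc']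
          rcases (hSm a).1 ha with h | h <;> omega
        · intro a
          simp only [M, mem_take_succ_iff hj, List.mem_append, hSm, List.mem_singleton]
          constructor
          · rintro ((h | h) | rfl)
            · exact .inl h
            · exact .inr ⟨.inl h.1, h.2⟩
            · exact .inr ⟨.inr rfl, hc'⟩
          · rintro (h | ⟨h | rfl, h'⟩)
            · exact .inl (.inl h)
            · exact .inl (.inr ⟨h, h'⟩)
            · exact .inr rfl
      · intro hc
        have hc' : height D L[j].1 ≠ r := by
          intro h; simp [h] at hc
        refine ⟨trivial, hm, by simpa using hr', hP _ _ _ _ (.inr rfl)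
          ⟨hs, hh, hz, S, hS, hSl, hSn, hSs, fun a => ?_⟩⟩
        rw [hSm]
        simp only [M, mem_take_succ_iff hj]
        refine or_congr Iff.rfl ⟨fun h => ⟨.inl h.1, h.2⟩, ?_⟩
        rintro ⟨h | rfl, h'⟩
        · exact ⟨h, h'⟩
        · exact absurd h' hc'
    · rintro s' ⟨hm, hr', hs⟩
      refine ⟨hr', hs.1.1, hP _ _ _ _ (.inl rfl) ?_⟩
      -- The end of round `r` is the start of round `r + 1`.
      convert hs using 1
      funext a
      simp only [M, List.take_length, List.take_zero, List.not_mem_nil, false_and, or_false,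
        Nat.lt_succ_iff_lt_or_eq, eq_iff_iff]
      tauto
  · rintro s' ⟨-, hs, hh, hz, S, hS, hSl, hSn, hSs, hSm⟩
    have hmem : ∀ a, a ∈ S ↔ a ∈ L := fun a => by
      rw [hSm]
      simp [M, hlt]
    refine ⟨hs, ⟨S, ⟨⟨hSn, fun u v => ?_⟩, hSs⟩, ?_, hS⟩, hz⟩
    · rw [hmem]; exact hL.2 u v
    · exact ((List.perm_ext_iff_of_nodup hSn hL.1).2 hmem).length_eq

end Sorting

/-! ### Marking vertices with two in-arcs or two out-arcs. -/

section Degrees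

variable {α β : Type*} [DecidableEq β] {κ : α → β} {T : List α} {f g : β → ℕ} {e : α}

/-- `g` is the indicator function of the keys occurring in `T`. -/
def IsMark (κ : α → β) (T : List α) (g : β → ℕ) : Prop :=
  ∀ v, (g v = 0 ∧ ∀ a ∈ T, κ a ≠ v) ∨ (g v = 1 ∧ ∃ a ∈ T, κ a = v)

/-- `f` is the indicator function of the keys occurring twice in `T`. -/
def IsDoubleMark (κ : α → β) (T : List α) (f : β → ℕ) : Prop :=
  ∀ v, (f v = 0 ∧ ∀ a ∈ T, ∀ b ∈ T, κ a = v → κ b = v → a = b) ∨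
    (f v = 1 ∧ ∃ a ∈ T, ∃ b ∈ T, κ a = v ∧ κ b = v ∧ a ≠ b)

omit [DecidableEq β] in
theorem IsMark.le_one (hg : IsMark κ T g) (v : β) : g v ≤ 1 := by
  rcases hg v with h | h <;> omega

theorem IsMark.concat (hg : IsMark κ T g) :
    IsMark κ (T ++ [e]) fun v => if v = κ e then 1 else g v := by
  intro v
  by_cases hv : v = κ e
  · exact .inr ⟨by simp [hv], e, by simp, hv.symm⟩
  · simp only [hv, if_false]
    rcases hg v with ⟨h, h'⟩ | ⟨h, a, ha, h'⟩
    · refine .inl ⟨h, fun a ha => ?_⟩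
      rw [List.mem_append, List.mem_singleton] at ha
      rcases ha with ha | rfl
      · exact h' a ha
      · exact fun h => hv h.symm
    · exact .inr ⟨h, a, by simp [ha], h'⟩

/-- The key of `e` now occurs twice exactly if it occurred before, so copying its old mark suffices;
this is why the programs copy a mark before setting it. -/
theorem IsDoubleMark.concat (hf : IsDoubleMark κ T f) (hg : IsMark κ T g) (he : e ∉ T) :
    IsDoubleMark κ (T ++ [e]) fun v => if v = κ e then g v else f v := by
  intro v
  by_cases hv : v = κ e
  · simp only [hv, if_true]
    rcases hg (κ e) with ⟨h, h'⟩ | ⟨h, a, ha, h'⟩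
    · refine .inl ⟨h, fun a ha b hb hav hbv => ?_⟩
      rw [List.mem_append, List.mem_singleton] at ha hb
      rcases ha with ha | rfl
      · exact absurd hav (h' a ha)
      rcases hb with hb | rfl
      · exact absurd hbv (h' b hb)
      · rfl
    · exact .inr ⟨h, a, by simp [ha], e, by simp, h', rfl, fun h => he (h ▸ ha)⟩
  · simp only [hv, if_false]
    rcases hf v with ⟨h, h'⟩ | ⟨h, a, ha, b, hb, h'⟩
    · refine .inl ⟨h, fun a ha b hb hav hbv => ?_⟩
      rw [List.mem_append, List.mem_singleton] at ha hb
      rcases ha with ha | rfl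
      · rcases hb with hb | rfl
        · exact h' a ha b hb hav hbv
        · exact absurd hbv.symm hv
      · exact absurd hav.symm hv
    · exact .inr ⟨h, a, by simp [ha], b, by simp [hb], h'⟩

/-- Marks the vertices with two incoming arcs in array `6`, those with two outgoing arcs in
array `9`. -/
def degreeProg : Prog :=
  loop 3 1
    (.seq (.put 6 (.get 1 (.reg 3)) (.get 7 (.get 1 (.reg 3))))
    (.seq (.put 7 (.get 1 (.reg 3)) (.const 1))
    (.seq (.put 9 (.get 0 (.reg 3)) (.get 8 (.get 0 (.reg 3))))
      (.put 8 (.get 0 (.reg 3)) (.const 1)))))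

theorem runs_degreeProg {n : ℕ} {L S : List (Fin n × Fin n)} {B : ℕ} (hL : L.Nodup)
    (hB : n + L.length + 2 ≤ B) {s : State} (hs : HoldsInput L s) (hS : HoldsArcs 3 4 S s)
    (h0 : ∀ a j, 4 < a → s.mem a j = 0) :
    Runs B degreeProg s (L.length * 40 + 6)
      (fun s' => HoldsInput L s' ∧ HoldsArcs 3 4 S s' ∧
        IsDoubleMark Prod.snd L (fun v => s'.mem 6 v) ∧
        IsDoubleMark Prod.fst L (fun v => s'.mem 9 v)) := by
  let I : ℕ → State → Prop := fun j s => HoldsInput L s ∧ HoldsArcs 3 4 S s ∧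
    IsMark Prod.snd (L.take j) (fun v => s.mem 7 v) ∧
    IsDoubleMark Prod.snd (L.take j) (fun v => s.mem 6 v) ∧
    IsMark Prod.fst (L.take j) (fun v => s.mem 8 v) ∧
    IsDoubleMark Prod.fst (L.take j) (fun v => s.mem 9 v)
  refine (Runs.loop (by decide) I (by omega) hs.2.1 ?_ ?_).mono
    (T' := L.length * 40 + 6) le_rfl ?_
  · refine ⟨by simpa [HoldsInput, HoldsArcs] using hs, by simpa [HoldsArcs] using hS, ?_⟩
    simp [IsMark, IsDoubleMark, h0]
  · rintro j s hj hi hm ⟨hs, hS, h7, h6, h8, h9⟩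
    obtain ⟨h1, h2⟩ := hs.2.2 j hj
    have hv1 := L[j].1.isLt
    have hv2 := L[j].2.isLt
    have hnot := getElem_notMem_take hL hj
    have b7 : s.mem 7 L[j].2 ≤ 1 := h7.le_one _
    have b8 : s.mem 8 L[j].1 ≤ 1 := h8.le_one _
    refine (Runs.of_wp ?_).mono (show _ ≤ 32 by decide) (fun _ h => h)
    simp only [Prog.wp, Expr.eval, hi, h1, h2, State.reg_setMem, State.mem_setMem,
      show (1 : ℕ) ≠ 6 by decide, show (0 : ℕ) ≠ 6 by decide,
      show (0 : ℕ) ≠ 7 by decide, show (0 : ℕ) ≠ 9 by decide, show (8 : ℕ) ≠ 6 by decide,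
      show (8 : ℕ) ≠ 7 by decide, false_and, if_false]
    refine ⟨by omega, by omega, by omega, by omega, by omega, by omega, by omega, by omega,
      trivial, hm, ?_, ?_, ?_, ?_, ?_, ?_⟩
    · simpa [HoldsInput, HoldsArcs] using hs
    · simpa [HoldsArcs] using hS
    · rw [List.take_succ_eq_append_getElem hj]
      convert h7.concat using 2 with v
      simp [Fin.val_inj]
    · rw [List.take_succ_eq_append_getElem hj]
      convert h6.concat h7 hnot using 2 with v
      by_cases hv : v = L[j].2 <;> simp [Fin.val_inj, hv]
    · rw [List.take_succ_eq_append_getElem hj]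
      convert h8.concat using 2 with v
      simp [Fin.val_inj]
    · rw [List.take_succ_eq_append_getElem hj]
      convert h9.concat h8 hnot using 2 with v
      by_cases hv : v = L[j].1 <;> simp [Fin.val_inj, hv]
  · rintro s' ⟨-, hs, hS, -, h6, -, h9⟩
    rw [List.take_length] at h6 h9
    exact ⟨hs, hS, h6, h9⟩

end Degrees

/-! ### Counting routes from a vertex, capped at two. -/

section Counting

variable {V : Type*}

/-- `c v` is the number of routes from `x` to `v` with arcs in `T`, or `2` if there are more. -/
def IsRouteCount (T : List (V × V)) (x : V) (c : V → ℕ) : Prop :=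
  ∀ v, (c v = 0 ∧ ∀ l, ¬ Route (fun a b => (a, b) ∈ T) x v l) ∨
    (c v = 1 ∧ ∃ l, Route (fun a b => (a, b) ∈ T) x v l ∧
      ∀ l', Route (fun a b => (a, b) ∈ T) x v l' → l' = l) ∨
    (c v = 2 ∧ ∃ l l', Route (fun a b => (a, b) ∈ T) x v l ∧
      Route (fun a b => (a, b) ∈ T) x v l' ∧ l ≠ l')

theorem IsRouteCount.le_two {T : List (V × V)} {x : V} {c : V → ℕ} (hc : IsRouteCount T x c)
    (v : V) : c v ≤ 2 := by
  rcases hc v with h | h | h <;> omega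

theorem isRouteCount_nil [DecidableEq V] (x : V) :
    IsRouteCount [] x fun v => if v = x then 1 else 0 := by
  intro v
  have h : ∀ l, Route (fun a b : V => (a, b) ∈ ([] : List (V × V))) x v l → l = [] ∧ v = x := by
    intro l hl
    rcases List.eq_nil_or_concat l with rfl | ⟨l, u, rfl⟩
    · exact ⟨rfl, route_nil.1 hl⟩
    · rw [List.concat_eq_append, route_snoc] at hl
      simp at hl
  by_cases hv : v = x
  · exact .inr (.inl ⟨by simp [hv], [], route_nil.2 hv, fun l hl => (h l hl).1⟩)
  · exact .inl ⟨by simp [hv], fun l hl => hv (h l hl).2⟩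

/-- No arc of `T` leaves `w`, so the new arc can only end a route: the new routes are those to `u`
prolonged to `w`, and all other counts stay. The capped sum is `2` as soon as both summands are
nonzero. -/
theorem IsRouteCount.concat [DecidableEq V] {T : List (V × V)} {x : V} {c : V → ℕ}
    (hc : IsRouteCount T x c) {u w : V} (huw : (u, w) ∉ T) (hne : u ≠ w)
    (hw : ∀ z, (w, z) ∉ T) :
    IsRouteCount (T ++ [(u, w)]) x
      fun v => if v = w ∧ c u ≠ 0 then (if c w ≠ 0 then 2 else c u) else c v := by
  have hmono : ∀ {v l}, Route (fun a b => (a, b) ∈ T) x v l →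
      Route (fun a b => (a, b) ∈ T ++ [(u, w)]) x v l :=
    fun h => h.mono fun a b hab => by simp [hab]
  have hsplit : ∀ {l v}, Route (fun a b => (a, b) ∈ T ++ [(u, w)]) x v l →
      Route (fun a b => (a, b) ∈ T) x v l ∨
        (v = w ∧ ∃ l', l = l' ++ [u] ∧ Route (fun a b => (a, b) ∈ T) x u l') := by
    intro l
    induction l using List.reverseRecOn with
    | nil => exact fun h => .inl (route_nil.2 (route_nil.1 h))
    | append_singleton l a ih =>
      intro v h
      rw [route_snoc] at h
      have ha : Route (fun a b => (a, b) ∈ T) x a l := by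
        rcases ih h.1 with h' | ⟨rfl, -⟩
        · exact h'
        · have := h.2
          rw [List.mem_append, List.mem_singleton, Prod.mk.injEq] at this
          rcases this with h' | h'
          · exact absurd h' (hw v)
          · exact absurd h'.1.symm hne
      have := h.2
      rw [List.mem_append, List.mem_singleton, Prod.mk.injEq] at this
      rcases this with h' | ⟨rfl, rfl⟩
      · exact .inl (route_snoc.2 ⟨ha, h'⟩)
      · exact .inr ⟨rfl, l, rfl, ha⟩
  have hnew : ∀ {l}, Route (fun a b => (a, b) ∈ T) x u l →
      Route (fun a b => (a, b) ∈ T ++ [(u, w)]) x w (l ++ [u]) :=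
    fun h => route_snoc.2 ⟨hmono h, by simp⟩
  intro v
  by_cases hv : v = w ∧ c u ≠ 0
  · obtain ⟨rfl, hu⟩ := hv
    simp only [hu, ne_eq, not_false_eq_true, and_self, if_true]
    by_cases hcv : c v = 0
    · have hno : ∀ l, ¬ Route (fun a b => (a, b) ∈ T) x v l := by
        rcases hc v with h | h | h
        · exact h.2
        · omega
        · omega
      simp only [hcv, not_true_eq_false, if_false]
      rcases hc u with h | ⟨h, l, hl, hl'⟩ | ⟨h, l, l', hl, hl', hne⟩
      · exact absurd h.1 hu
      · refine .inr (.inl ⟨h, l ++ [u], hnew hl, fun l' h' => ?_⟩)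
        rcases hsplit h' with h1 | ⟨-, l1, rfl, h1⟩
        · exact absurd h1 (hno _)
        · rw [hl' _ h1]
      · exact .inr (.inr ⟨h, _, _, hnew hl, hnew hl', by simpa using hne⟩)
    · simp only [hcv, not_false_eq_true, if_true]
      have h1 : ∃ l, Route (fun a b => (a, b) ∈ T) x v l := by
        rcases hc v with h | ⟨-, l, hl, -⟩ | ⟨-, l, -, hl, -⟩
        · exact absurd h.1 hcv
        · exact ⟨l, hl⟩
        · exact ⟨l, hl⟩
      have h2 : ∃ l, Route (fun a b => (a, b) ∈ T) x u l := by
        rcases hc u with h | ⟨-, l, hl, -⟩ | ⟨-, l, -, hl, -⟩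
        · exact absurd h.1 hu
        · exact ⟨l, hl⟩
        · exact ⟨l, hl⟩
      obtain ⟨l, hl⟩ := h1
      obtain ⟨l', hl'⟩ := h2
      refine .inr (.inr ⟨trivial, l, l' ++ [u], hmono hl, hnew hl', ?_⟩)
      rintro rfl
      exact huw (route_snoc.1 hl).2
  · simp only [hv, if_false]
    have hiff : ∀ l, Route (fun a b => (a, b) ∈ T ++ [(u, w)]) x v l ↔
        Route (fun a b => (a, b) ∈ T) x v l := by
      refine fun l => ⟨fun h => ?_, hmono⟩
      rcases hsplit h with h1 | ⟨rfl, l', rfl, h1⟩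
      · exact h1
      · rcases hc u with h' | h' | h'
        · exact absurd h1 (h'.2 _)
        · exact absurd ⟨rfl, by omega⟩ hv
        · exact absurd ⟨rfl, by omega⟩ hv
    simp only [hiff]
    exact hc v

/-- Computes in array `5` the number of routes from the tail of the arc with number `reg 2`. -/
def countProg : Prog :=
  .seq (loop 3 0 (.put 5 (.reg 3) (.const 0)))
  (.seq (.put 5 (.get 3 (.reg 2)) (.const 1))
    (loop 3 1
      (.ite (.get 5 (.get 3 (.reg 3)))
        (.ite (.get 5 (.get 4 (.reg 3)))
          (.put 5 (.get 4 (.reg 3)) (.const 2))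
          (.put 5 (.get 4 (.reg 3)) (.get 5 (.get 3 (.reg 3)))))
        .skip)))

/-- The part of the state that is not changed by `countProg`. -/
def CountFrame {n : ℕ} (L S : List (Fin n × Fin n)) (i : ℕ) (f g : Fin n → ℕ) (s : State) : Prop :=
  HoldsInput L s ∧ HoldsArcs 3 4 S s ∧ s.reg 2 = i ∧ (∀ v : Fin n, s.mem 6 v = f v) ∧
    ∀ v : Fin n, s.mem 9 v = g v

theorem CountFrame.setReg {n : ℕ} {L S : List (Fin n × Fin n)} {i : ℕ} {f g : Fin n → ℕ}
    {s : State} (h : CountFrame L S i f g s) (x : ℕ) : CountFrame L S i f g (s.setReg 3 x) := by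
  simpa [CountFrame, HoldsInput, HoldsArcs] using h

theorem CountFrame.setMem {n : ℕ} {L S : List (Fin n × Fin n)} {i : ℕ} {f g : Fin n → ℕ}
    {s : State} (h : CountFrame L S i f g s) (j x : ℕ) :
    CountFrame L S i f g (s.setMem 5 j x) := by
  simpa [CountFrame, HoldsInput, HoldsArcs] using h

/-- Sorting by the height of the tail is a topological order: the head of an arc is higher than its
tail, so no arc processed earlier leaves that head, and one sweep is enough. -/
theorem runs_countProg {n : ℕ} {D : Digraph (Fin n)} {L S : List (Fin n × Fin n)} {B : ℕ}
    (hN : ∀ W : List (Fin n), W.IsChain D.Adj → W.Nodup) (hS : IsSortedArcList D S)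
    (hSL : S.length = L.length) (hB : n + L.length + 2 ≤ B) {i : ℕ} (hi : i < S.length)
    {f g : Fin n → ℕ} {s : State} (hs : CountFrame L S i f g s) :
    Runs B countProg s (n * 16 + L.length * 48 + 20)
      (fun s' => CountFrame L S i f g s' ∧
        IsRouteCount S S[i].1 (fun v => s'.mem 5 v)) := by
  rw [show n * 16 + L.length * 48 + 20 = (n * (8 + 8) + 6) + (8 + (L.length * (40 + 8) + 6)) by ring]
  refine Runs.seq ((Runs.loop (by decide)
    (fun k s => CountFrame L S i f g s ∧ ∀ v : Fin n, (v : ℕ) < k → s.mem 5 v = 0)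
    (by omega) hs.1.1 ⟨hs.setReg 0, by simp⟩ ?_).mono le_rfl fun _ h => h) ?_
  · rintro k s hk h3 hn ⟨hs, h⟩
    refine (Runs.of_wp ?_).mono (show _ ≤ 8 by decide) (fun _ h => h)
    simp only [Prog.wp, Expr.eval, h3]
    refine ⟨by omega, by omega, h3, hn, (hs.setMem _ _).setReg _, fun v hv => ?_⟩
    simp only [State.mem_setReg, State.mem_setMem, true_and]
    split_ifs with hvk
    · rfl
    · exact h v (by omega)
  rintro s ⟨-, hs, h5⟩
  refine Runs.seq (Q := fun s => CountFrame L S i f g s ∧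
    IsRouteCount (S.take 0) S[i].1 (fun v => s.mem 5 v)) ((Runs.of_wp ?_).mono
      (show _ ≤ 8 by decide) fun _ h => h) ?_
  · have h3 := (hs.2.1 i hi).1
    have hx := S[i].1.isLt
    simp only [Prog.wp, Expr.eval, hs.2.2.1, h3]
    refine ⟨by omega, by omega, hs.setMem _ _, ?_⟩
    rw [List.take_zero]
    convert isRouteCount_nil S[i].1 using 2 with v
    simp [Fin.val_inj, h5 v v.isLt]
  rintro s ⟨hs, h5⟩
  refine (Runs.loop (by decide) (fun j s => CountFrame L S i f g s ∧
    IsRouteCount (S.take j) S[i].1 (fun v => s.mem 5 v)) (by omega) hs.1.2.1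
    ⟨hs.setReg 0, h5⟩ ?_).mono le_rfl ?_
  · rintro j s hj' h3 hm ⟨hs, hc⟩
    have hj : j < S.length := by omega
    obtain ⟨h1, h2⟩ := hs.2.1 j hj
    have hv2 := S[j].2.isLt
    have hadj : height D S[j].1 < height D S[j].2 :=
      height_lt_of_adj hN ((hS.1.2 _ _).1 (List.getElem_mem hj))
    have hstep := hc.concat (u := S[j].1) (w := S[j].2) (getElem_notMem_take hS.1.1 hj)
      (fun h => by rw [h] at hadj; omega) (fun z hz => by
        obtain ⟨k, hk, hk'⟩ := List.mem_take_iff_getElem.1 hz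
        have := List.pairwise_iff_getElem.1 hS.2 k j (by omega) hj (by omega)
        rw [hk'] at this
        simp only at this
        omega)
    have b1 : s.mem 5 S[j].1 ≤ 2 := hc.le_two _
    rw [Prod.mk.eta, ← List.take_succ_eq_append_getElem hj] at hstep
    refine (Runs.of_wp ?_).mono (show _ ≤ 40 by decide) (fun _ h => h)
    simp only [Prog.wp, Expr.eval, h3, h1, h2]
    refine ⟨fun hu => ⟨fun hw => ?_, fun hw => ?_⟩, fun hu => ?_⟩
    · refine ⟨by omega, by omega, h3, hm, (hs.setMem _ _).setReg _, ?_⟩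
      convert hstep using 2 with v
      simp [Fin.val_inj, hu, hw]
    · refine ⟨by omega, by omega, h3, hm, (hs.setMem _ _).setReg _, ?_⟩
      convert hstep using 2 with v
      simp [Fin.val_inj, hu, hw]
    · refine ⟨trivial, hm, hs.setReg _, ?_⟩
      convert hstep using 2 with v
      simp [hu]
  · rintro s ⟨-, hs, hc⟩
    rw [← hSL, List.take_length] at hc
    exact ⟨hs, hc⟩

end Counting

/-! ### Propagating levels and taking the maximum. -/

section Relaxation

variable {n : ℕ} {D : Digraph (Fin n)} {L S : List (Fin n × Fin n)} {B : ℕ}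

/-- The values `f` with the vertices reached from `x` taken into account, where `c` counts the
routes from `x`. -/
def relax (x : Fin n) (c f : Fin n → ℕ) (v : Fin n) : ℕ :=
  if c v = 0 then f v else max (f v) (f x + (c v - 1))

theorem le_relax (x : Fin n) (c f : Fin n → ℕ) (v : Fin n) : f v ≤ relax x c f v := by
  unfold relax
  split_ifs <;> simp

/-- The values `f` are attained levels that respect the routes from the tails of the first `i`
arcs of `S`. -/
structure IsLevelBound (D : Digraph (Fin n)) (S : List (Fin n × Fin n)) (i : ℕ)
    (f : Fin n → ℕ) : Prop where
  level : ∀ v, Level D v (f v)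
  indegree : ∀ u u' v, D.Adj u v → D.Adj u' v → u ≠ u' → 1 ≤ f v
  route : ∀ j (hj : j < S.length), j < i → ∀ v l, Route D.Adj S[j].1 v l → f S[j].1 ≤ f v
  routes : ∀ j (hj : j < S.length), j < i → ∀ v l l', Route D.Adj S[j].1 v l →
    Route D.Adj S[j].1 v l' → l ≠ l' → f S[j].1 + 1 ≤ f v

theorem isRouteCount_iff_adj (hS : IsArcList D S) {x : Fin n} {c : Fin n → ℕ} :
    IsRouteCount S x c ↔ ∀ v, (c v = 0 ∧ ∀ l, ¬ Route D.Adj x v l) ∨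
      (c v = 1 ∧ ∃ l, Route D.Adj x v l ∧ ∀ l', Route D.Adj x v l' → l' = l) ∨
      (c v = 2 ∧ ∃ l l', Route D.Adj x v l ∧ Route D.Adj x v l' ∧ l ≠ l') := by
  have : (fun a b => (a, b) ∈ S) = D.Adj := funext₂ fun u v => propext (hS.2 u v)
  simp only [IsRouteCount, this]

variable (hN : ∀ W : List (Fin n), W.IsChain D.Adj → W.Nodup)
include hN

theorem IsRouteCount.self_eq_one (hS : IsArcList D S) {x : Fin n} {c : Fin n → ℕ}
    (hc : IsRouteCount S x c) : c x = 1 := by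
  rcases (isRouteCount_iff_adj hS).1 hc x with h | h | ⟨-, l, l', hl, hl', hne⟩
  · exact absurd (route_nil.2 rfl) (h.2 [])
  · exact h.1
  · exact absurd (((route_self_iff hN).1 hl).trans ((route_self_iff hN).1 hl').symm) hne

/-- Nonempty routes strictly raise the height, so the values at the tails of the arcs up to `i` do
not change. The earlier inequalities keep their left sides while the right sides can only grow. -/
theorem IsLevelBound.relax (hS : IsSortedArcList D S) {i : ℕ} (hi : i < S.length)
    {c f : Fin n → ℕ} (hf : IsLevelBound D S i f) (hc : IsRouteCount S S[i].1 c) :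
    IsLevelBound D S (i + 1) (relax S[i].1 c f) := by
  have hcx := hc.self_eq_one hN hS.1
  have hc' := (isRouteCount_iff_adj hS.1).1 hc
  have hx : ∀ j (hj : j < S.length), j < i + 1 →
      EarAnonymity.relax S[i].1 c f S[j].1 = f S[j].1 := by
    intro j hj hji
    unfold EarAnonymity.relax
    split_ifs with h
    · rfl
    · have hr : ∃ l, Route D.Adj S[i].1 S[j].1 l := by
        rcases hc' S[j].1 with h' | ⟨-, l, hl, -⟩ | ⟨-, l, -, hl, -⟩
        · exact absurd h'.1 h
        · exact ⟨l, hl⟩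
        · exact ⟨l, hl⟩
      obtain ⟨l, hl⟩ := hr
      have h1 := height_add_length_le hN hl
      have h2 : height D S[j].1 ≤ height D S[i].1 := by
        rcases Nat.lt_succ_iff_lt_or_eq.1 hji with hji | rfl
        · exact List.pairwise_iff_getElem.1 hS.2 j i hj hi hji
        · rfl
      have h3 : l = [] := by
        rw [← List.length_eq_zero_iff]; omega
      subst h3
      rw [route_nil.1 hl, hcx]
      simp
  refine ⟨fun v => ?_, fun u u' v hu hu' hne =>
    (hf.indegree u u' v hu hu' hne).trans (le_relax _ _ _ _), ?_, ?_⟩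
  · unfold EarAnonymity.relax
    rcases hc' v with h | ⟨h, l, hl, -⟩ | ⟨h, l, l', hl, hl', hne⟩
    · simpa [h.1] using hf.level v
    · rw [h, if_neg (by decide)]
      rcases max_choice (f v) (f S[i].1 + (1 - 1)) with h' | h'
      · rw [h']; exact hf.level v
      · rw [h']; exact (hf.level _).route hl
    · rw [h, if_neg (by decide)]
      rcases max_choice (f v) (f S[i].1 + (2 - 1)) with h' | h'
      · rw [h']; exact hf.level v
      · rw [h']; exact (hf.level _).routes hl hl' hne
  · intro j hj hji v l hl
    rw [hx j hj hji]
    rcases Nat.lt_succ_iff_lt_or_eq.1 hji with hji | rfl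
    · exact (hf.route j hj hji v l hl).trans (le_relax _ _ _ _)
    · unfold EarAnonymity.relax
      rw [if_neg]
      · exact le_max_of_le_right (Nat.le_add_right _ _)
      · intro h
        rcases hc' v with h' | h' | h'
        · exact h'.2 _ hl
        · omega
        · omega
  · intro j hj hji v l l' hl hl' hne
    rw [hx j hj hji]
    rcases Nat.lt_succ_iff_lt_or_eq.1 hji with hji | rfl
    · exact (hf.routes j hj hji v l l' hl hl' hne).trans (le_relax _ _ _ _)
    · have : c v = 2 := by
        rcases hc' v with h' | ⟨-, l1, -, h'⟩ | h'
        · exact absurd hl (h'.2 _)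
        · exact absurd ((h' _ hl).trans (h' _ hl').symm) hne
        · exact h'.1
      unfold EarAnonymity.relax
      rw [this, if_neg (by decide)]
      exact le_max_right _ _

-- A nonempty route starts at the tail of some arc, and of two distinct routes one is nonempty; the
-- inequalities at tails therefore cover every rule of `Level`.
omit hN in
theorem IsLevelBound.le_of_level (hS : IsArcList D S) {f : Fin n → ℕ}
    (hf : IsLevelBound D S S.length f) {v : Fin n} {k : ℕ} (h : Level D v k) : k ≤ f v := by
  have htail : ∀ {x v : Fin n} {l}, Route D.Adj x v l → l ≠ [] →
      ∃ j, ∃ hj : j < S.length, S[j].1 = x := by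
    intro x v l hl hne
    rcases hl.eq_nil_or with h | ⟨l, rfl⟩
    · exact absurd h.1 hne
    · obtain ⟨z, t, hz⟩ := List.exists_cons_of_ne_nil (show l ++ [v] ≠ [] by simp)
      have h1 := hl.1
      rw [List.cons_append, hz, List.isChain_cons_cons] at h1
      obtain ⟨j, hj, hj'⟩ := List.getElem_of_mem ((hS.2 x z).2 h1.1)
      exact ⟨j, hj, by rw [hj']⟩
  induction h with
  | zero v => simp
  | indegree hu hu' hne => exact hf.indegree _ _ _ hu hu' hne
  | @route x v k l hx hl ih =>
    by_cases h : l = []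
    · subst h
      rw [route_nil.1 hl]
      exact ih
    · obtain ⟨j, hj, rfl⟩ := htail hl h
      exact ih.trans (hf.route j hj hj v l hl)
  | @routes x v k l l' hx hl hl' hne ih =>
    have : ∃ j, ∃ hj : j < S.length, S[j].1 = x := by
      by_cases h : l = []
      · subst h
        exact htail hl' hne.symm
      · exact htail hl h
    obtain ⟨j, hj, rfl⟩ := this
    have := hf.routes j hj hj v l l' hl hl' hne
    omega

/-- Replaces the values in array `6` by their relaxation from the tail of arc number `reg 2`. -/
def relaxProg : Prog :=
  loop 3 0
    (.ite (.get 5 (.reg 3))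
      (.ite (.lt (.get 6 (.reg 3))
          (.add (.get 6 (.get 3 (.reg 2))) (.sub (.get 5 (.reg 3)) (.const 1))))
        (.put 6 (.reg 3) (.add (.get 6 (.get 3 (.reg 2))) (.sub (.get 5 (.reg 3)) (.const 1))))
        .skip)
      .skip)

omit hN in
theorem runs_relaxProg (hB : n + L.length + 2 ≤ B) {i : ℕ} (hi : i < S.length)
    {f g c : Fin n → ℕ} (hcx : c S[i].1 = 1) (hfB : ∀ v, relax S[i].1 c f v ≤ B) {s : State}
    (hs : CountFrame L S i f g s) (hc : ∀ v : Fin n, s.mem 5 v = c v) :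
    Runs B relaxProg s (n * 48 + 6) (fun s' => CountFrame L S i (relax S[i].1 c f) g s') := by
  let F : ℕ → Fin n → ℕ := fun k v => if (v : ℕ) < k then relax S[i].1 c f v else f v
  refine (Runs.loop (by decide) (fun k s => CountFrame L S i (F k) g s ∧
    ∀ v : Fin n, s.mem 5 v = c v) (by omega) hs.1.1 ?_ ?_).mono (T' := n * 48 + 6) le_rfl ?_
  · exact ⟨by simpa [F] using hs.setReg 0, hc⟩
  · rintro k s hk h3 hn ⟨hs, hc⟩
    have hx := (hs.2.1 i hi).1
    -- This cell is read throughout while the array is overwritten. It is stable: the count at the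
    -- tail is `1`, so relaxation adds `0` there.
    have h6x : s.mem 6 S[i].1 = f S[i].1 := by
      rw [hs.2.2.2.1]
      simp [F, relax, hcx]
    have h6 : s.mem 6 k = f ⟨k, hk⟩ := by
      have := hs.2.2.2.1 ⟨k, hk⟩
      simpa [F] using this
    have h5 : s.mem 5 k = c ⟨k, hk⟩ := hc ⟨k, hk⟩
    have hb := hfB ⟨k, hk⟩
    have hF : ∀ v : Fin n, F (k + 1) v =
        if (v : ℕ) = k then relax S[i].1 c f ⟨k, hk⟩ else F k v := by
      intro v
      by_cases hv : (v : ℕ) = k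
      · have : v = ⟨k, hk⟩ := Fin.ext hv
        simp [F, this]
      · simp only [F, hv, if_false]
        congr 1
        exact propext (by omega)
    have hid : relax S[i].1 c f ⟨k, hk⟩ = f ⟨k, hk⟩ →
        CountFrame L S i (F (k + 1)) g (s.setReg 3 (k + 1)) ∧
          ∀ v : Fin n, (s.setReg 3 (k + 1)).mem 5 v = c v := by
      intro h
      have : F (k + 1) = F k := by
        funext v
        rw [hF]
        split_ifs with hv
        · have : v = ⟨k, hk⟩ := Fin.ext hv
          simp [F, this, h]
        · rfl
      rw [this]
      exact ⟨hs.setReg _, hc⟩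
    refine (Runs.of_wp ?_).mono (show _ ≤ 40 by decide) (fun _ h => h)
    simp only [Prog.wp, Expr.eval, h3, h5, hs.2.2.1, hx, h6, h6x]
    refine ⟨fun h0 => ⟨fun h1 => ?_, fun h1 => ?_⟩, fun h0 => ?_⟩
    · have h1' : f ⟨k, hk⟩ < f S[i].1 + (c ⟨k, hk⟩ - 1) := by
        by_contra h; simp [h] at h1
      have hr : relax S[i].1 c f ⟨k, hk⟩ = f S[i].1 + (c ⟨k, hk⟩ - 1) := by
        rw [relax, if_neg h0, max_eq_right h1'.le]
      obtain ⟨a1, a2, a3, a4, a5⟩ := hs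
      refine ⟨by omega, by omega, h3, hn, ⟨?_, ?_, ?_, ?_, ?_⟩, ?_⟩
      · simpa [HoldsInput, HoldsArcs] using a1
      · simpa [HoldsArcs] using a2
      · simpa using a3
      · intro v
        rw [hF, hr]
        simp only [State.mem_setReg, State.mem_setMem, true_and, a4]
      · simpa using a5
      · simpa using hc
    · have h1' : ¬ f ⟨k, hk⟩ < f S[i].1 + (c ⟨k, hk⟩ - 1) := by
        intro h; simp [h] at h1
      refine ⟨trivial, hn, hid ?_⟩
      rw [relax, if_neg h0, max_eq_left (not_lt.1 h1')]
    · exact ⟨trivial, hn, hid (by rw [relax, if_pos h0])⟩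
  · rintro s ⟨-, hs, -⟩
    simpa [F] using hs

/-- Computes in array `6` the maximal levels of the vertices. -/
def levelProg : Prog := loop 2 1 (.seq countProg relaxProg)

/-- The rounds run over arcs instead of vertices; a tail with several out-arcs is treated
repeatedly, which is harmless. -/
theorem runs_levelProg (hS : IsSortedArcList D S) (hSL : S.length = L.length)
    (hB : n + L.length + 2 ≤ B) {f g : Fin n → ℕ} (hf : IsLevelBound D S 0 f) {s : State}
    (hs : HoldsInput L s) (hsS : HoldsArcs 3 4 S s) (h6 : ∀ v : Fin n, s.mem 6 v = f v)
    (h9 : ∀ v : Fin n, s.mem 9 v = g v) :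
    Runs B levelProg s (L.length * (n * 64 + L.length * 48 + 34) + 6)
      (fun s' => HoldsInput L s' ∧ (∀ v : Fin n, s'.mem 9 v = g v) ∧
        IsLevelBound D S S.length (fun v => s'.mem 6 v)) := by
  refine (Runs.loop (T := n * 64 + L.length * 48 + 26) (by decide)
    (fun i s => HoldsInput L s ∧ HoldsArcs 3 4 S s ∧ (∀ v : Fin n, s.mem 9 v = g v) ∧
      IsLevelBound D S i (fun v => s.mem 6 v)) (by omega) hs.2.1 ?_ ?_).mono
    (T' := L.length * (n * 64 + L.length * 48 + 34) + 6) le_rfl ?_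
  · refine ⟨by simpa [HoldsInput, HoldsArcs] using hs, by simpa [HoldsArcs] using hsS,
      by simpa using h9, ?_⟩
    simpa [h6] using hf
  · rintro i s hi' h2 hm ⟨hs, hsS, h9, hf⟩
    have hi : i < S.length := by omega
    refine (Runs.seq (runs_countProg hN hS hSL hB hi (f := fun v => s.mem 6 v)
      ⟨hs, hsS, h2, fun _ => rfl, h9⟩) (T' := n * 48 + 6)
      (Q' := fun s' => s'.reg 2 = i ∧ s'.reg 1 = L.length ∧ HoldsInput L (s'.setReg 2 (i + 1)) ∧
        HoldsArcs 3 4 S (s'.setReg 2 (i + 1)) ∧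
        (∀ v : Fin n, (s'.setReg 2 (i + 1)).mem 9 v = g v) ∧
        IsLevelBound D S (i + 1) (fun v => (s'.setReg 2 (i + 1)).mem 6 v)) ?_).mono
      (by omega) fun _ h => h
    rintro s' ⟨hs', hc⟩
    have hbound := hf.relax hN hS hi hc
    refine (runs_relaxProg hB hi (hc.self_eq_one hN hS.1) (fun v => ?_) hs' fun _ => rfl).mono
      le_rfl ?_
    -- Each relaxed value is an attained level, hence less than `n`.
    · have h1 := (hbound.level v).le_height hN
      have h2 := height_lt_card hN v
      rw [Fintype.card_fin] at h2
      omega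
    · rintro t ⟨a1, a2, a3, a4, a5⟩
      refine ⟨a3, a1.2.1, by simpa [HoldsInput, HoldsArcs] using a1, by simpa [HoldsArcs] using a2,
        by simpa using a5, ?_⟩
      simpa only [State.mem_setReg, a4] using hbound
  · rintro s' ⟨-, hs, -, h9, hf⟩
    exact ⟨hs, h9, hSL ▸ hf⟩

/-- Stores in register `0` the maximum of `1` and of the sums of the values in the arrays `6`
and `9`. -/
def maxProg : Prog :=
  .seq (.set 5 (.const 1))
  (.seq (loop 3 0
      (.ite (.lt (.reg 5) (.add (.get 6 (.reg 3)) (.get 9 (.reg 3))))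
        (.set 5 (.add (.get 6 (.reg 3)) (.get 9 (.reg 3))))
        .skip))
    (.set 0 (.reg 5)))

omit hN in
theorem runs_maxProg (hB : n + 1 ≤ B) {f g : Fin n → ℕ} (hfg : ∀ v, f v + g v ≤ B) {s : State}
    (hn : s.reg 0 = n) (h6 : ∀ v : Fin n, s.mem 6 v = f v) (h9 : ∀ v : Fin n, s.mem 9 v = g v) :
    Runs B maxProg s (n * 32 + 16) (fun s' => 1 ≤ s'.reg 0 ∧ (∀ v, f v + g v ≤ s'.reg 0) ∧
      (s'.reg 0 = 1 ∨ ∃ v, s'.reg 0 = f v + g v)) := by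
  let I : ℕ → State → Prop := fun k s => (∀ v : Fin n, s.mem 6 v = f v) ∧
    (∀ v : Fin n, s.mem 9 v = g v) ∧ s.reg 5 ≤ B ∧ 1 ≤ s.reg 5 ∧
    (∀ v : Fin n, (v : ℕ) < k → f v + g v ≤ s.reg 5) ∧ (s.reg 5 = 1 ∨ ∃ v, s.reg 5 = f v + g v)
  rw [show n * 32 + 16 = 2 + ((n * (24 + 8) + 6) + 8) by ring]
  refine Runs.seq (Q := fun s => s.reg 0 = n ∧ I 0 s) (Runs.of_wp ?_) fun s hs => ?_
  · simp only [Prog.wp, Expr.eval]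
    exact ⟨by omega, by simpa using hn, by simpa using h6, by simpa using h9, by simp; omega,
      by simp, by simp, by simp⟩
  refine Runs.seq ((Runs.loop (by decide) I (by omega) hs.1 ?_ ?_).mono le_rfl fun _ h => h) ?_
  · simpa [I] using hs.2
  · rintro k s hk h3 hn ⟨h6, h9, hB5, h1, hle, hatt⟩
    have hk6 : s.mem 6 k = f ⟨k, hk⟩ := h6 ⟨k, hk⟩
    have hk9 : s.mem 9 k = g ⟨k, hk⟩ := h9 ⟨k, hk⟩
    have hkB := hfg ⟨k, hk⟩
    have hv : ∀ v : Fin n, (v : ℕ) < k + 1 → (v : ℕ) < k ∨ v = ⟨k, hk⟩ := by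
      intro v hv
      rw [Fin.ext_iff]
      simp only
      omega
    refine (Runs.of_wp ?_).mono (show _ ≤ 24 by decide) (fun _ h => h)
    simp only [Prog.wp, Expr.eval, h3, hk6, hk9]
    refine ⟨fun hc => ?_, fun hc => ?_⟩
    · have hc' : s.reg 5 < f ⟨k, hk⟩ + g ⟨k, hk⟩ := by
        by_contra h; simp [h] at hc
      refine ⟨by omega, by simpa using h3, by simpa using hn, by simpa using h6, by simpa using h9,
        by simpa using hkB, by simp; omega, fun v hvk => ?_, .inr ⟨⟨k, hk⟩, by simp⟩⟩
      rcases hv v hvk with h | rfl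
      · have := hle v h
        simp; omega
      · simp
    · have hc' : ¬ s.reg 5 < f ⟨k, hk⟩ + g ⟨k, hk⟩ := by
        intro h; simp [h] at hc
      refine ⟨trivial, hn, by simpa using h6, by simpa using h9,
        by simpa using hB5, by simpa using h1, fun v hvk => ?_, by simpa using hatt⟩
      rcases hv v hvk with h | rfl
      · simpa using hle v h
      · simpa using hc'
  · rintro s ⟨-, -, -, hB5, h1, hle, hatt⟩
    refine (Runs.of_wp ?_).mono (show _ ≤ 8 by decide) (fun _ h => h)
    simp only [Prog.wp, Expr.eval]
    exact ⟨hB5, by simpa using h1, by simpa using hle, by simpa using hatt⟩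

end Relaxation

/-! ### The complete algorithm. -/

section Main

/-- Computes the ear anonymity of an acyclic digraph. -/
def anonProg : Prog :=
  .ite (.reg 1)
    (.seq heightProg (.seq sortProg (.seq degreeProg (.seq levelProg maxProg))))
    (.set 0 (.const 0))

variable {n : ℕ} {D : Digraph (Fin n)} {L : List (Fin n × Fin n)} {B : ℕ}

theorem holdsInput_inputState : HoldsInput L (inputState n L) := by
  refine ⟨by simp [inputState], by simp [inputState], fun j hj => ?_⟩
  simp [inputState, hj]

theorem runs_anonProg (hN : ∀ W : List (Fin n), W.IsChain D.Adj → W.Nodup) (hL : IsArcList D L)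
    (hB : n + L.length + 2 ≤ B) :
    Runs B anonProg (inputState n L) (250 * (L.length * (n + L.length) + 1))
      (fun s => s.reg 0 = anon D) := by
  -- Without arcs only constant time is allowed, so not even one pass over the vertices; the program
  -- answers `0` at once.
  by_cases hm : L.length = 0
  · have hD : ∀ u v, ¬ D.Adj u v := by
      intro u v h
      have := (hL.2 u v).2 h
      rw [List.length_eq_zero_iff] at hm
      simp [hm] at this
    refine ⟨_, _, .iteFalse (by simp [Expr.eval, inputState, hm])
      (.set _ 0 (.const 0) (by simp [Expr.eval])), by simp [Expr.cost]; omega, ?_⟩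
    simp [Expr.eval, anon_eq_zero hD]
  have key : Runs B (.seq heightProg (.seq sortProg (.seq degreeProg (.seq levelProg maxProg))))
      (inputState n L) ((n * (L.length * 40 + 14) + 6) + ((n * (L.length * 40 + 14) + 8) +
        ((L.length * 40 + 6) + ((L.length * (n * 64 + L.length * 48 + 34) + 6) + (n * 32 + 16)))))
      (fun s => s.reg 0 = anon D) := by
    refine Runs.seq (runs_heightProg hN hL hB holdsInput_inputState ?_) ?_
    · intro a j ha
      simp [inputState, show a ≠ 0 by omega, show a ≠ 1 by omega]
    rintro s ⟨hs, hh, h0⟩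
    refine Runs.seq (runs_sortProg hN hL hB hs hh h0) ?_
    rintro s ⟨hs, ⟨S, hS, hSL, hsS⟩, h0⟩
    refine Runs.seq (runs_degreeProg hL.1 hB hs hsS h0) ?_
    rintro s ⟨hs, hsS, h6, h9⟩
    have h9' : ∀ v : Fin n, (s.mem 9 v = 0 ∧ ¬ Branching D v) ∨ (s.mem 9 v = 1 ∧ Branching D v) := by
      intro v
      rcases h9 v with ⟨h, h'⟩ | ⟨h, a, ha, b, hb, rfl, hbv, hne⟩
      · refine .inl ⟨h, ?_⟩
        rintro ⟨w, w', hw, hw', hne⟩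
        have := h' _ ((hL.2 _ _).2 hw) _ ((hL.2 _ _).2 hw') rfl rfl
        exact hne (congrArg Prod.snd this)
      · refine .inr ⟨h, a.2, b.2, (hL.2 _ _).1 ha, (hL.2 _ _).1 ?_, fun h => hne ?_⟩
        · rw [← hbv]; exact hb
        · exact Prod.ext hbv.symm h
    -- The mark of in-degree at least two doubles as the initial level.
    have hf : IsLevelBound D S 0 (fun v => s.mem 6 v) := by
      refine ⟨fun v => ?_, fun u u' v hu hu' hne => ?_, by simp, by simp⟩
      · rcases h6 v with ⟨h, -⟩ | ⟨h, a, ha, b, hb, rfl, hbv, hne⟩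
        · simp only at h
          rw [h]; exact .zero v
        · simp only at h
          rw [h]
          refine .indegree (u := a.1) (u' := b.1) ((hL.2 _ _).1 ha) ((hL.2 _ _).1 ?_) fun h => hne ?_
          · rw [← hbv]; exact hb
          · exact Prod.ext h hbv.symm
      · rcases h6 v with ⟨h, h'⟩ | ⟨h, -⟩
        · have := h' _ ((hL.2 _ _).2 hu) _ ((hL.2 _ _).2 hu') rfl rfl
          exact absurd (congrArg Prod.fst this) hne
        · exact h.ge
    generalize hg : (fun v : Fin n => s.mem 9 v) = g at *
    have hg' : ∀ v : Fin n, s.mem 9 v = g v := fun v => congrFun hg v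
    simp only [hg'] at h9'
    refine Runs.seq (runs_levelProg hN hS hSL hB hf hs hsS (fun _ => rfl) hg') ?_
    rintro s ⟨hs, h9, hf⟩
    have hle : ∀ v : Fin n, s.mem 6 v < n := by
      intro v
      have h1 := (hf.level v).le_height hN
      have h2 := height_lt_card hN v
      rw [Fintype.card_fin] at h2
      omega
    refine (runs_maxProg (by omega) (fun v => ?_) hs.1 (fun v => rfl) h9).mono le_rfl ?_
    · have := hle v
      rcases h9' v with h | h <;> omega
    · rintro t ⟨h1, h2, h3⟩
      have hmax := fun v k (h : Level D v k) => hf.le_of_level hS.1 h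
      refine (anon_eq_of_level hN ?_ h1 (fun v k h hb => ?_) (fun v k h => ?_) ?_).symm
      · obtain ⟨a, ha⟩ := List.exists_mem_of_length_pos (Nat.pos_of_ne_zero hm)
        exact ⟨a.1, a.2, (hL.2 _ _).1 ha⟩
      · have := hmax v k h
        have := h2 v
        rcases h9' v with h' | h'
        · exact absurd hb h'.2
        · omega
      · have := hmax v k h
        have := h2 v
        omega
      · rcases h3 with h3 | ⟨v, hv⟩
        · exact .inl h3
        · rcases h9' v with h' | h'
          · rw [h'.1, add_zero] at hv
            exact .inr (.inl ⟨v, hv ▸ hf.level v⟩)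
          · rw [h'.1] at hv
            exact .inr (.inr ⟨v, _, hf.level v, h'.2, hv⟩)
  obtain ⟨t, s, h1, h2, h3⟩ := key
  refine ⟨_, s, .iteTrue (by simpa [Expr.eval, inputState] using hm) h1, ?_, h3⟩
  -- With at least one arc, the terms linear in `n` and `m` are absorbed by `mn` and `m * m`.
  have h4 : n ≤ L.length * n := Nat.le_mul_of_pos_left n (Nat.pos_of_ne_zero hm)
  have h5 : L.length ≤ L.length * L.length := Nat.le_mul_of_pos_left _ (Nat.pos_of_ne_zero hm)
  simp only [Expr.cost]
  nlinarith

end Main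

end EarAnonymity

/-- There are a program and a constant `c` such that, for every acyclic digraph `D` with `n`
vertices and `m = L.length` arcs, given by its arc list `L`, the program computes the ear
anonymity of `D` in at most `c * (m * (n + m) + 1)` steps, on a machine whose cells hold numbers
of at most `O(log (n + m + 2))` bits. -/
theorem mainTheorem1 :
    ∃ (p : EarAnonymity.Prog) (c : ℕ),
      ∀ (n : ℕ) (D : Digraph (Fin n)) (L : List (Fin n × Fin n)),
        (∀ v : Fin n, ¬ D.Adj v v) → EarAnonymity.IsAcyclic D → EarAnonymity.IsArcList D L →
        ∃ (t : ℕ) (s : EarAnonymity.State),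
          EarAnonymity.Exec ((n + L.length + 2) ^ c) p (EarAnonymity.inputState n L) t s ∧
            s.reg 0 = EarAnonymity.anon D ∧
            t ≤ c * (L.length * (n + L.length) + 1) := by
  -- The constant comes from the step count and also serves as exponent; of the word bound only `n +
  -- m + 2 ≤ B` matters.
  refine ⟨EarAnonymity.anonProg, 250, fun n D L hloop hD hL => ?_⟩
  obtain ⟨t, s, h1, h2, h3⟩ := EarAnonymity.runs_anonProg
    (fun _ hW => hD.nodup_of_isChain hloop hW) hL
    (Nat.le_self_pow (n := 250) (by decide) (n + L.length + 2))
  exact ⟨t, s, h1, h3, h2⟩
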